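/- Let $L,\tau,\eta,\kappa,\beta>0$ and let $m,\delta,p\in W^{1,\infty}(0,L)$ be real-valued (identified with their continuous representatives on $[0,L]$) with $m(x),\delta(x),p(x)>0$ for all $x\in[0,L]$. Consider, for $x\in(0,L)$, $t\ge 0$, the system $$m\,u_{tt}-(p\,u_x+2\delta\,u_{xt})_x+\eta\,\theta_x=0,\qquad \theta_t+\kappa\,q_x+\eta\,u_{xt}=0,\qquad \tau\,q_t+\beta\,q+\kappa\,\theta_x=0,$$ with $u=0$ at $x=0,L$ and with either (1) $\theta=0$ at $x=0,L$, or (2) $q=0$ at $x=0,L$. Let $\mathcal H=H^1_0(0,L)\times L^2(0,L)\times L^2(0,L)\times L^2(0,L)$ (complex-valued functions), with the inner product $$\langle U^1,U^2\rangle_{\mathcal H}=\int_0^L p\,u^1_x\overline{u^2_x}\,dx+\int_0^L m\,w^1\overline{w^2}\,dx+\int_0^L\theta^1\overline{\theta^2}\,dx+\tau\int_0^L q^1\overline{q^2}\,dx,\qquad U^i=(u^i,w^i,\theta^i,q^i).$$ Let $$\mathcal D_1=\{(u,w,\theta,q)\in\mathcal H:\ w\in H^1_0,\ p\,u_x+2\delta\,w_x\in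 H^1,\ \theta\in H^1_0,\ q\in H^1\},$$ $$\mathcal D_2=\{(u,w,\theta,q)\in\mathcal H:\ w\in H^1_0,\ p\,u_x+2\delta\,w_x\in H^1,\ \theta\in H^1,\ q\in H^1_0\},$$ and let $\mathcal A_i:\mathcal D_i\to\mathcal H$, $i=1,2$, be given by $$\mathcal A_i(u,w,\theta,q)=\Big(w,\ \tfrac1m\big(p\,u_x+2\delta\,w_x-\eta\,\theta\big)_x,\ -\kappa\,q_x-\eta\,w_x,\ -\tfrac1\tau(\kappa\,\theta_x+\beta\,q)\Big).$$ With $w=u_t$ and $U=(u,w,\theta,q)$, the system with boundary conditions ($i$) is the Cauchy problem $U'=\mathcal A_iU$, $U(0)=U_0$. A mild solution of it is a function $U\in C([0,\infty);\mathcal H)$ such that, for all $t\ge0$, $\int_0^tU(s)\,ds\in\mathcal D_i$ and $U(t)=U_0+\mathcal A_i\int_0^tU(s)\,ds$. Theorem. Let $i\in\{1,2\}$. For every $U_0\in\mathcal H$ there is a unique mild solution $U\in C([0,\infty);\mathcal H)$. If moreover $U_0\in\mathcal D_i$, then $U\in C^1([0,\infty);\mathcal H)\cap C([0,\infty);\mathcal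 D_i)$, where $\mathcal D_i$ carries the graph norm of $\mathcal A_i$, and $U$ solves the problem in the strong sense: $U(0)=U_0$ and $U'(t)=\mathcal A_iU(t)$ for all $t\ge0$. -/

import Mathlib

open MeasureTheory Set
open scoped ContDiff ComplexConjugate NNReal ENNReal

noncomputable section

namespace Cattaneo

/-! ### Sobolev spaces on the interval `(0, L)` -/

/-- Lebesgue measure on `(0, L)`. -/
abbrev vol (L : ℝ) : Measure ℝ := volume.restrict (Ioo 0 L)

/-- The complex space `L²(0, L)`. -/
abbrev L2 (L : ℝ) : Type := Lp ℂ 2 (vol L)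

/-- Test functions: smooth, with compact support contained in `(0, L)`. -/
structure IsTest {𝕜 : Type*} [RCLike 𝕜] (L : ℝ) (φ : ℝ → 𝕜) : Prop where
  smooth : ContDiff ℝ ∞ φ
  compact : HasCompactSupport φ
  supp : tsupport φ ⊆ Ioo 0 L

/-- `g` is a weak derivative of `u` on `(0, L)`. -/
def HasWeakDeriv {𝕜 : Type*} [RCLike 𝕜] (L : ℝ) (u g : ℝ → 𝕜) : Prop :=
  ∀ φ : ℝ → 𝕜, IsTest L φ → ∫ x, u x * deriv φ x ∂(vol L) = -∫ x, g x * φ x ∂(vol L)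

/-- The real-valued Sobolev space `W^{1,∞}(0, L)`. -/
def MemW1Inf (L : ℝ) (a : ℝ → ℝ) : Prop :=
  MemLp a ∞ (vol L) ∧ ∃ g : ℝ → ℝ, MemLp g ∞ (vol L) ∧ HasWeakDeriv L a g

section Sobolev

variable {L : ℝ}

lemma IsTest.memLp {φ : ℝ → ℂ} (h : IsTest L φ) : MemLp φ 2 (vol L) :=
  (h.smooth.continuous.memLp_of_hasCompactSupport h.compact).restrict _

lemma IsTest.deriv {φ : ℝ → ℂ} (h : IsTest L φ) : IsTest L (deriv φ) where
  smooth := (contDiff_infty_iff_deriv.mp h.smooth).2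
  compact := h.compact.deriv
  supp := (closure_mono (support_deriv_subset (f := φ))).trans (by
    simpa [tsupport] using h.supp)

lemma integrable_mul_coe {ψ : ℝ → ℂ} (hψ : MemLp ψ 2 (vol L)) (f : L2 L) :
    Integrable (fun x => f x * ψ x) (vol L) := (Lp.memLp f).integrable_mul hψ

lemma continuous_integral_mul {ψ : ℝ → ℂ} (hψ : MemLp ψ 2 (vol L)) :
    Continuous fun f : L2 L => ∫ x, f x * ψ x ∂(vol L) := by
  have h : (fun f : L2 L => ∫ x, f x * ψ x ∂(vol L)) =
      fun f : L2 L => inner ℂ (hψ.star.toLp (star ψ)) f := by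
    funext f
    rw [L2.inner_def]
    refine integral_congr_ae ?_
    filter_upwards [hψ.star.coeFn_toLp] with x hx
    simp [hx, RCLike.inner_apply]
  rw [h]
  fun_prop

/-- The graph of the weak derivative on `L²(0, L)`. -/
def weakGraph (L : ℝ) : Submodule ℂ (L2 L × L2 L) where
  carrier := {z | HasWeakDeriv L z.1 z.2}
  zero_mem' := by
    intro φ _
    have h0 : ((0 : L2 L) : ℝ → ℂ) =ᵐ[vol L] 0 := Lp.coeFn_zero _ _ _
    rw [integral_eq_zero_of_ae, integral_eq_zero_of_ae, neg_zero]
    all_goals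
      filter_upwards [h0] with x hx
      simp only [Prod.fst_zero, Prod.snd_zero, hx, Pi.zero_apply, zero_mul]
  add_mem' := by
    intro a b ha hb φ hφ
    have h1 : ∀ (f g : L2 L) (ψ : ℝ → ℂ), IsTest L ψ →
        ∫ x, (f + g) x * ψ x ∂(vol L) = ∫ x, f x * ψ x ∂(vol L) + ∫ x, g x * ψ x ∂(vol L) := by
      intro f g ψ hψ
      rw [← integral_add (integrable_mul_coe hψ.memLp f) (integrable_mul_coe hψ.memLp g)]
      refine integral_congr_ae ?_
      filter_upwards [Lp.coeFn_add f g] with x hx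
      rw [hx, Pi.add_apply, add_mul]
    change ∫ x, (a.1 + b.1) x * _root_.deriv φ x ∂(vol L) = -∫ x, (a.2 + b.2) x * φ x ∂(vol L)
    rw [h1 _ _ _ hφ.deriv, h1 _ _ _ hφ, ha φ hφ, hb φ hφ]
    ring
  smul_mem' := by
    intro c a ha φ hφ
    have h1 : ∀ (f : L2 L) (ψ : ℝ → ℂ),
        ∫ x, (c • f) x * ψ x ∂(vol L) = c * ∫ x, f x * ψ x ∂(vol L) := by
      intro f ψ
      rw [← integral_const_mul]
      refine integral_congr_ae ?_
      filter_upwards [Lp.coeFn_smul c f] with x hx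
      rw [hx, Pi.smul_apply, smul_eq_mul, mul_assoc]
    change ∫ x, (c • a.1) x * _root_.deriv φ x ∂(vol L) = -∫ x, (c • a.2) x * φ x ∂(vol L)
    rw [h1, h1, ha φ hφ]
    ring

/-- A weak derivative is unique (fundamental lemma of the calculus of variations). -/
lemma weakGraph_unique (z : L2 L × L2 L) (hz : z ∈ weakGraph L) (h0 : z.1 = 0) : z.2 = 0 := by
  have key : ∀ᵐ x ∂volume, x ∈ Ioo 0 L → (z.2 : ℝ → ℂ) x = 0 := by
    refine isOpen_Ioo.ae_eq_zero_of_integral_contDiff_smul_eq_zero ?_ ?_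
    · have : Integrable (z.2 : ℝ → ℂ) (vol L) := (Lp.memLp z.2).integrable (by norm_num)
      exact IntegrableOn.locallyIntegrableOn this
    · intro g hg hgc hgs
      let φ : ℝ → ℂ := fun x => (g x : ℂ)
      have hsupp : tsupport φ ⊆ tsupport g := closure_mono fun x hx => by
        simpa [φ] using hx
      have hφ : IsTest L φ :=
        ⟨Complex.ofRealCLM.contDiff.comp hg,
          hgc.comp_left (g := fun y : ℝ => (y : ℂ)) (by simp), hsupp.trans hgs⟩
      have h := hz φ hφ
      have hz1 : ∫ x, z.1 x * _root_.deriv φ x ∂(vol L) = 0 := by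
        rw [h0]
        refine integral_eq_zero_of_ae ?_
        filter_upwards [Lp.coeFn_zero ℂ 2 (vol L)] with x hx
        rw [hx, Pi.zero_apply, zero_mul]
      rw [hz1, eq_comm, neg_eq_zero] at h
      have h2 : ∫ x, g x • z.2 x ∂(vol L) = 0 := by
        rw [← h]
        refine integral_congr_ae (Filter.Eventually.of_forall fun x => ?_)
        simp [φ, mul_comm]
      rw [← h2]
      refine (setIntegral_eq_integral_of_forall_compl_eq_zero fun x hx => ?_).symm
      have : g x = 0 := by
        by_contra hne
        exact hx (hgs (subset_tsupport g hne))
      simp [this]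
  rw [Lp.eq_zero_iff_ae_eq_zero]
  exact (ae_restrict_iff' measurableSet_Ioo).mpr key

/-- The weak derivative as an unbounded operator on `L²(0, L)`. -/
def weakDeriv (L : ℝ) : L2 L →ₗ.[ℂ] L2 L := (weakGraph L).toLinearPMap

/-- `H¹(0, L)`: the functions in `L²(0, L)` that have a weak derivative in `L²(0, L)`. -/
def H1 (L : ℝ) : Submodule ℂ (L2 L) := (weakDeriv L).domain

/-- The derivative `u ↦ u_x` on `H¹(0, L)`. -/
def dx (L : ℝ) : H1 L →ₗ[ℂ] L2 L := (weakDeriv L).toFun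

lemma dx_spec (u : H1 L) : HasWeakDeriv L (u : L2 L) (dx L u) :=
  Submodule.mem_graph_toLinearPMap (g := weakGraph L) weakGraph_unique u

lemma mem_H1_iff {u : L2 L} : u ∈ H1 L ↔ ∃ g : L2 L, HasWeakDeriv L u g := by
  constructor
  · intro h
    exact ⟨_, dx_spec ⟨u, h⟩⟩
  · rintro ⟨g, hg⟩
    exact ⟨(u, g), hg, rfl⟩

lemma dx_eq {u g : L2 L} (h : HasWeakDeriv L u g) (hu : u ∈ H1 L) : dx L ⟨u, hu⟩ = g := by
  have h1 : ((u, dx L ⟨u, hu⟩) : L2 L × L2 L) ∈ weakGraph L := dx_spec ⟨u, hu⟩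
  have h2 : ((u, g) : L2 L × L2 L) ∈ weakGraph L := h
  have h3 := weakGraph_unique _ ((weakGraph L).sub_mem h1 h2) (by simp)
  exact sub_eq_zero.mp h3

/-- The pairs `(φ, φ')` with `φ` a test function. -/
def testGraph (L : ℝ) : Submodule ℂ (L2 L × L2 L) where
  carrier := {z | ∃ φ : ℝ → ℂ, IsTest L φ ∧ z.1 =ᵐ[vol L] φ ∧ z.2 =ᵐ[vol L] deriv φ}
  zero_mem' := by
    refine ⟨0, ⟨contDiff_const, HasCompactSupport.zero, by simp [tsupport]⟩, ?_, ?_⟩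
    · exact Lp.coeFn_zero _ _ _
    · filter_upwards [Lp.coeFn_zero ℂ 2 (vol L)] with x hx
      rw [Prod.snd_zero, hx]
      simp
  add_mem' := by
    rintro a b ⟨φ, hφ, h1, h2⟩ ⟨ψ, hψ, h3, h4⟩
    refine ⟨φ + ψ, ⟨hφ.smooth.add hψ.smooth, hφ.compact.add hψ.compact,
      (tsupport_add φ ψ).trans (union_subset hφ.supp hψ.supp)⟩, ?_, ?_⟩
    · filter_upwards [Lp.coeFn_add a.1 b.1, h1, h3] with x hx hx1 hx3
      rw [Prod.fst_add, hx, Pi.add_apply, hx1, hx3, Pi.add_apply]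
    · filter_upwards [Lp.coeFn_add a.2 b.2, h2, h4] with x hx hx1 hx3
      rw [deriv_add (hφ.smooth.differentiable (by simp) x) (hψ.smooth.differentiable (by simp) x)]
      rw [Prod.snd_add, hx, Pi.add_apply, hx1, hx3]
  smul_mem' := by
    rintro c a ⟨φ, hφ, h1, h2⟩
    refine ⟨c • φ, ⟨contDiff_const.smul hφ.smooth, hφ.compact.smul_left (f := fun _ => c),
      (closure_mono (Function.support_const_smul_subset c φ)).trans hφ.supp⟩, ?_, ?_⟩
    · filter_upwards [Lp.coeFn_smul c a.1, h1] with x hx hx1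
      rw [Prod.smul_fst, hx, Pi.smul_apply, hx1, Pi.smul_apply]
    · filter_upwards [Lp.coeFn_smul c a.2, h2] with x hx hx1
      rw [deriv_const_smul c (hφ.smooth.differentiable (by simp) x)]
      rw [Prod.smul_snd, hx, Pi.smul_apply, hx1]

/-- `H¹₀(0, L)`: the closure of the test functions in the norm of `H¹(0, L)`, that is, the
functions `u` such that `φₙ → u` and `φₙ' → g` in `L²` for some test functions `φₙ` and
some `g` (which is then `u_x`). -/
def H10 (L : ℝ) : Submodule ℂ (L2 L) :=
  (testGraph L).topologicalClosure.map (LinearMap.fst ℂ (L2 L) (L2 L))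

lemma closure_testGraph_le : (testGraph L).topologicalClosure ≤ weakGraph L := by
  refine Submodule.topologicalClosure_minimal _ ?_ ?_
  · rintro z ⟨φ, hφ, h1, h2⟩ ψ hψ
    have e1 : ∫ x, z.1 x * deriv ψ x ∂(vol L) = ∫ x, φ x * deriv ψ x := by
      rw [← setIntegral_eq_integral_of_forall_compl_eq_zero (μ := volume) (s := Ioo 0 L)
        (f := fun x => φ x * deriv ψ x)]
      · refine integral_congr_ae ?_
        filter_upwards [h1] with x hx
        rw [hx]
      · intro x hx
        rw [image_eq_zero_of_notMem_tsupport fun h => hx (hφ.supp h), zero_mul]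
    have e2 : ∫ x, z.2 x * ψ x ∂(vol L) = ∫ x, deriv φ x * ψ x := by
      rw [← setIntegral_eq_integral_of_forall_compl_eq_zero (μ := volume) (s := Ioo 0 L)
        (f := fun x => deriv φ x * ψ x)]
      · refine integral_congr_ae ?_
        filter_upwards [h2] with x hx
        rw [hx]
      · intro x hx
        rw [image_eq_zero_of_notMem_tsupport fun h => hx (hψ.supp h), mul_zero]
    rw [e1, e2]
    have i1 : Integrable (φ * deriv ψ) :=
      (hφ.smooth.continuous.mul hψ.deriv.smooth.continuous).integrable_of_hasCompactSupport
        hφ.compact.mul_right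
    have i2 : Integrable (deriv φ * ψ) :=
      (hφ.deriv.smooth.continuous.mul hψ.smooth.continuous).integrable_of_hasCompactSupport
        hψ.compact.mul_left
    have i3 : Integrable (φ * ψ) :=
      (hφ.smooth.continuous.mul hψ.smooth.continuous).integrable_of_hasCompactSupport
        hφ.compact.mul_right
    exact integral_mul_deriv_eq_deriv_mul_of_integrable
      (fun x _ => (hφ.smooth.differentiable (by simp) x).hasDerivAt)
      (fun x _ => (hψ.smooth.differentiable (by simp) x).hasDerivAt) i1 i2 i3
  · have : ((weakGraph L : Submodule ℂ (L2 L × L2 L)) : Set (L2 L × L2 L)) =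
        ⋂ (φ : ℝ → ℂ) (_ : IsTest L φ), {z : L2 L × L2 L |
          ∫ x, z.1 x * deriv φ x ∂(vol L) = -∫ x, z.2 x * φ x ∂(vol L)} := by
      ext z
      simp only [mem_iInter]
      exact Iff.rfl
    rw [this]
    refine isClosed_iInter fun φ => isClosed_iInter fun hφ => isClosed_eq ?_ ?_
    · exact (continuous_integral_mul hφ.deriv.memLp).comp continuous_fst
    · exact ((continuous_integral_mul hφ.memLp).comp continuous_snd).neg

lemma H10_le_H1 : H10 L ≤ H1 L := by
  rintro u ⟨z, hz, rfl⟩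
  exact mem_H1_iff.mpr ⟨z.2, closure_testGraph_le hz⟩

/-- The derivative `u ↦ u_x` on `H¹₀(0, L)`. -/
def dx0 (L : ℝ) : H10 L →ₗ[ℂ] L2 L := dx L ∘ₗ Submodule.inclusion H10_le_H1

lemma dx0_mem (u : H10 L) : ((u : L2 L), dx0 L u) ∈ (testGraph L).topologicalClosure := by
  obtain ⟨u, z, hz, rfl⟩ := u
  have : dx0 L ⟨_, z, hz, rfl⟩ = z.2 := dx_eq (closure_testGraph_le hz) _
  rw [this]
  exact hz

lemma vol_univ : vol L univ = ENNReal.ofReal L := by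
  simp

lemma integral_norm_le (hL : 0 ≤ L) (g : L2 L) :
    ∫ x, ‖g x‖ ∂(vol L) ≤ L ^ (2⁻¹ : ℝ) * ‖g‖ := by
  have hg := Lp.memLp g
  have h1 := eLpNorm_le_eLpNorm_mul_rpow_measure_univ (p := 1) (q := 2) (μ := vol L)
    (by norm_num) hg.1
  have hfin : eLpNorm g 2 (vol L) * (vol L univ) ^ (1 / (1 : ℝ≥0∞).toReal - 1 / (2 : ℝ≥0∞).toReal)
      ≠ ⊤ := ENNReal.mul_ne_top hg.2.ne
        (ENNReal.rpow_ne_top_of_nonneg (by norm_num) (measure_ne_top _ _))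
  have h2 := ENNReal.toReal_mono hfin h1
  rw [eLpNorm_one_eq_lintegral_enorm, ← integral_norm_eq_lintegral_enorm hg.1,
    ENNReal.toReal_mul, ← ENNReal.toReal_rpow, vol_univ, ENNReal.toReal_ofReal hL,
    ← Lp.norm_def] at h2
  refine h2.trans (le_of_eq ?_)
  rw [mul_comm]
  norm_num

lemma IsTest.norm_le {φ : ℝ → ℂ} (h : IsTest L φ) {g : L2 L} (hg : g =ᵐ[vol L] _root_.deriv φ)
    (hL : 0 ≤ L) {x : ℝ} (hx : x ∈ Ioo 0 L) : ‖φ x‖ ≤ L ^ (2⁻¹ : ℝ) * ‖g‖ := by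
  refine le_trans ?_ (integral_norm_le hL g)
  have h0 : φ 0 = 0 := image_eq_zero_of_notMem_tsupport fun h' => absurd (h.supp h').1 (lt_irrefl _)
  have hd : φ x = ∫ y in (0 : ℝ)..x, _root_.deriv φ y := by
    rw [intervalIntegral.integral_deriv_eq_sub
      (fun y _ => h.smooth.differentiable (by simp) y)
      (h.deriv.smooth.continuous.intervalIntegrable _ _), h0, sub_zero]
  have hi : Integrable (fun y => ‖_root_.deriv φ y‖) (vol L) :=
    (h.deriv.memLp.integrable (by norm_num)).norm
  rw [hd]
  calc ‖∫ y in (0 : ℝ)..x, _root_.deriv φ y‖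
      ≤ ∫ y in (0 : ℝ)..x, ‖_root_.deriv φ y‖ :=
        intervalIntegral.norm_integral_le_integral_norm hx.1.le
    _ = ∫ y in Ioo 0 x, ‖_root_.deriv φ y‖ := by
        rw [intervalIntegral.integral_of_le hx.1.le, integral_Ioc_eq_integral_Ioo]
    _ ≤ ∫ y, ‖_root_.deriv φ y‖ ∂(vol L) :=
        setIntegral_mono_set hi (Filter.Eventually.of_forall fun _ => norm_nonneg _)
          (Ioo_subset_Ioo_right hx.2.le).eventuallyLE
    _ = ∫ y, ‖g y‖ ∂(vol L) := by
        refine integral_congr_ae ?_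
        filter_upwards [hg] with y hy
        rw [hy]

lemma poincare_test (hL : 0 ≤ L) (z : L2 L × L2 L) (hz : z ∈ testGraph L) :
    ‖z.1‖ ≤ L * ‖z.2‖ := by
  obtain ⟨φ, hφ, h1, h2⟩ := hz
  have hb : ∀ᵐ x ∂(vol L), ‖z.1 x‖ ≤ L ^ (2⁻¹ : ℝ) * ‖z.2‖ := by
    filter_upwards [h1, ae_restrict_mem measurableSet_Ioo] with x hx hxm
    rw [hx]
    exact hφ.norm_le h2 hL hxm
  have h3 := Lp.norm_le_of_ae_bound (by positivity) hb
  have h4 : ((measureUnivNNReal (vol L) : ℝ≥0) : ℝ) = L := by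
    rw [← ENNReal.coe_toReal, coe_measureUnivNNReal, vol_univ, ENNReal.toReal_ofReal hL]
  have h5 : L ^ ((2 : ℝ≥0∞).toReal⁻¹) * L ^ (2⁻¹ : ℝ) = L := by
    rw [ENNReal.toReal_ofNat, ← Real.rpow_add_of_nonneg hL (by norm_num) (by norm_num)]
    norm_num
  rw [h4, ← mul_assoc, h5] at h3
  exact h3

/-- Poincaré's inequality on `H¹₀(0, L)`. -/
lemma poincare (hL : 0 ≤ L) (u : H10 L) : ‖(u : L2 L)‖ ≤ L * ‖dx0 L u‖ := by
  have h : closure (testGraph L : Set (L2 L × L2 L)) ⊆ {z | ‖z.1‖ ≤ L * ‖z.2‖} :=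
    closure_minimal (fun z hz => by
      rw [mem_ofPred_eq]
      exact poincare_test hL z hz)
      (isClosed_le continuous_fst.norm (continuous_const.mul continuous_snd.norm))
  have h2 : ((u : L2 L), dx0 L u) ∈ closure (testGraph L : Set (L2 L × L2 L)) := dx0_mem u
  have h3 := h h2
  rwa [mem_ofPred_eq] at h3

end Sobolev

/-! ### The weighted phase space -/

section Weights

variable {L : ℝ}

lemma memLp_mul {a : ℝ → ℝ} (ha : ContinuousOn a (Icc 0 L)) (f : L2 L) :
    MemLp (fun x => (a x : ℂ) * f x) 2 (vol L) := by
  obtain ⟨C, hC⟩ := isCompact_Icc.exists_bound_of_continuousOn ha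
  have hm : AEStronglyMeasurable a (vol L) :=
    (ha.mono Ioo_subset_Icc_self).aestronglyMeasurable measurableSet_Ioo
  refine (Lp.memLp f).of_le_mul (c := C)
    ((Complex.continuous_ofReal.comp_aestronglyMeasurable hm).mul (Lp.memLp f).1) ?_
  filter_upwards [ae_restrict_mem measurableSet_Ioo] with x hx
  rw [norm_mul, Complex.norm_real]
  exact mul_le_mul_of_nonneg_right (hC x (Ioo_subset_Icc_self hx)) (norm_nonneg _)

/-- Multiplication by the continuous function `a` on `L²(0, L)`. -/
def mulL2 (a : ℝ → ℝ) (ha : ContinuousOn a (Icc 0 L)) : L2 L →ₗ[ℂ] L2 L where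
  toFun f := (memLp_mul ha f).toLp _
  map_add' f g := by
    rw [← MemLp.toLp_add, MemLp.toLp_eq_toLp_iff]
    filter_upwards [Lp.coeFn_add f g] with x hx
    simp only [Pi.add_apply, hx, mul_add]
  map_smul' c f := by
    rw [RingHom.id_apply, ← MemLp.toLp_const_smul, MemLp.toLp_eq_toLp_iff]
    filter_upwards [Lp.coeFn_smul c f] with x hx
    simp only [Pi.smul_apply, hx, smul_eq_mul, mul_left_comm]

/-- The weighted form `∫₀ᴸ a f ḡ dx`. -/
def wform (a : ℝ → ℝ) (f g : L2 L) : ℂ := ∫ x, (a x : ℂ) * f x * conj (g x) ∂(vol L)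

lemma wform_eq_inner {a : ℝ → ℝ} (ha : ContinuousOn a (Icc 0 L)) (f g : L2 L) :
    wform a f g = inner ℂ g (mulL2 a ha f) := by
  rw [L2.inner_def, wform]
  refine integral_congr_ae ?_
  filter_upwards [(memLp_mul ha f).coeFn_toLp] with x hx
  rw [RCLike.inner_apply]
  erw [hx]

lemma wform_conj (a : ℝ → ℝ) (f g : L2 L) : conj (wform a f g) = wform a g f := by
  rw [wform, wform, ← integral_conj]
  refine integral_congr_ae (Filter.Eventually.of_forall fun x => ?_)
  simp
  ring

lemma wform_self (a : ℝ → ℝ) (f : L2 L) :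
    wform a f f = ((∫ x, a x * ‖f x‖ ^ 2 ∂(vol L) : ℝ) : ℂ) := by
  rw [wform, ← integral_complex_ofReal]
  refine integral_congr_ae (Filter.Eventually.of_forall fun x => ?_)
  simp [mul_assoc, Complex.mul_conj, Complex.normSq_eq_norm_sq]

lemma integral_norm_sq (f : L2 L) : ∫ x, ‖f x‖ ^ 2 ∂(vol L) = ‖f‖ ^ 2 := by
  have h : inner ℂ f f = ((∫ x, ‖f x‖ ^ 2 ∂(vol L) : ℝ) : ℂ) := by
    rw [L2.inner_def, ← integral_complex_ofReal]
    refine integral_congr_ae (Filter.Eventually.of_forall fun x => ?_)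
    simp [inner_self_eq_norm_sq_to_K]
  rw [inner_self_eq_norm_sq_to_K] at h
  exact Complex.ofReal_injective (by rw [← h]; simp)

lemma integrable_weight {a : ℝ → ℝ} (ha : ContinuousOn a (Icc 0 L)) (f : L2 L) :
    Integrable (fun x => a x * ‖f x‖ ^ 2) (vol L) := by
  refine ((Lp.memLp f).norm.integrable_mul (memLp_mul ha f).norm).congr ?_ |>.mono'
    (g := fun x => |a x| * ‖f x‖ ^ 2) ?_ ?_
  · refine Filter.Eventually.of_forall fun x => ?_
    simp
    ring
  · exact ((ha.mono Ioo_subset_Icc_self).aestronglyMeasurable measurableSet_Ioo).mul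
      ((Lp.memLp f).1.norm.pow 2)
  · refine Filter.Eventually.of_forall fun x => ?_
    simp

lemma wform_bounds {a : ℝ → ℝ} (hL : 0 < L) (ha : ContinuousOn a (Icc 0 L))
    (hpos : ∀ x ∈ Icc 0 L, 0 < a x) : ∃ c C : ℝ, 0 < c ∧ 0 < C ∧ ∀ f : L2 L,
      c * ‖f‖ ^ 2 ≤ (wform a f f).re ∧ (wform a f f).re ≤ C * ‖f‖ ^ 2 := by
  have hne : (Icc (0 : ℝ) L).Nonempty := nonempty_Icc.mpr hL.le
  obtain ⟨x₀, hx₀, h₀⟩ := isCompact_Icc.exists_isMinOn hne ha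
  obtain ⟨x₁, hx₁, h₁⟩ := isCompact_Icc.exists_isMaxOn hne ha
  have hone : ∀ f : L2 L, Integrable (fun x => ‖f x‖ ^ 2) (vol L) := fun f => by
    simpa using integrable_weight (a := fun _ => 1) continuousOn_const f
  refine ⟨a x₀, a x₁, hpos _ hx₀, hpos _ hx₁, fun f => ?_⟩
  rw [wform_self, Complex.ofReal_re, ← integral_norm_sq, ← integral_const_mul,
    ← integral_const_mul]
  constructor
  · refine integral_mono_ae ((hone f).const_mul _) (integrable_weight ha f) ?_
    filter_upwards [ae_restrict_mem measurableSet_Ioo] with x hx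
    exact mul_le_mul_of_nonneg_right (h₀ (Ioo_subset_Icc_self hx)) (by positivity)
  · refine integral_mono_ae (integrable_weight ha f) ((hone f).const_mul _) ?_
    filter_upwards [ae_restrict_mem measurableSet_Ioo] with x hx
    exact mul_le_mul_of_nonneg_right (h₁ (Ioo_subset_Icc_self hx)) (by positivity)

end Weights

/-- The physical data: the length, the positive constants, and the positive coefficients
`m, δ, p ∈ W^{1,∞}(0, L)`, given by their continuous representatives on `[0, L]`. -/
structure Beam where
  L : ℝ
  τ : ℝ
  η : ℝ
  κ : ℝ
  β : ℝ
  m : ℝ → ℝ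
  δ : ℝ → ℝ
  p : ℝ → ℝ
  L_pos : 0 < L
  τ_pos : 0 < τ
  η_pos : 0 < η
  κ_pos : 0 < κ
  β_pos : 0 < β
  m_mem : MemW1Inf L m
  δ_mem : MemW1Inf L δ
  p_mem : MemW1Inf L p
  m_cont : ContinuousOn m (Icc 0 L)
  δ_cont : ContinuousOn δ (Icc 0 L)
  p_cont : ContinuousOn p (Icc 0 L)
  m_pos : ∀ x ∈ Icc 0 L, 0 < m x
  δ_pos : ∀ x ∈ Icc 0 L, 0 < δ x
  p_pos : ∀ x ∈ Icc 0 L, 0 < p x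

/-- The phase space `H¹₀(0, L) × L²(0, L) × L²(0, L) × L²(0, L)`. -/
def PhaseSpace (B : Beam) : Type := H10 B.L × L2 B.L × L2 B.L × L2 B.L

namespace PhaseSpace

variable {B : Beam}

instance : AddCommGroup (PhaseSpace B) :=
  inferInstanceAs (AddCommGroup (H10 B.L × L2 B.L × L2 B.L × L2 B.L))

instance : Module ℂ (PhaseSpace B) :=
  inferInstanceAs (Module ℂ (H10 B.L × L2 B.L × L2 B.L × L2 B.L))

/-- The element `(u, w, θ, q)` of the phase space. -/
def mk (u : H10 B.L) (w θ q : L2 B.L) : PhaseSpace B := (u, w, θ, q)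

/-- The component `u` of `U = (u, w, θ, q)`; `w`, `θ` and `q` below are the others. -/
def u : PhaseSpace B →ₗ[ℂ] H10 B.L where
  toFun U := U.1
  map_add' _ _ := rfl
  map_smul' _ _ := rfl

def w : PhaseSpace B →ₗ[ℂ] L2 B.L where
  toFun U := U.2.1
  map_add' _ _ := rfl
  map_smul' _ _ := rfl

def θ : PhaseSpace B →ₗ[ℂ] L2 B.L where
  toFun U := U.2.2.1
  map_add' _ _ := rfl
  map_smul' _ _ := rfl

def q : PhaseSpace B →ₗ[ℂ] L2 B.L where
  toFun U := U.2.2.2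
  map_add' _ _ := rfl
  map_smul' _ _ := rfl

@[simp] lemma u_mk (v : H10 B.L) (w' θ' q' : L2 B.L) : u (mk v w' θ' q') = v := rfl

@[simp] lemma w_mk (v : H10 B.L) (w' θ' q' : L2 B.L) : w (mk v w' θ' q') = w' := rfl

@[simp] lemma θ_mk (v : H10 B.L) (w' θ' q' : L2 B.L) : θ (mk v w' θ' q') = θ' := rfl

@[simp] lemma q_mk (v : H10 B.L) (w' θ' q' : L2 B.L) : q (mk v w' θ' q') = q' := rfl

lemma ext' {U V : PhaseSpace B} (h1 : u U = u V) (h2 : w U = w V) (h3 : θ U = θ V)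
    (h4 : q U = q V) : U = V :=
  Prod.ext h1 (Prod.ext h2 (Prod.ext h3 h4))

/-- The weighted inner product, linear in `U` and conjugate linear in `V`:
`∫ p u_x v̄_x + ∫ m w w̄' + ∫ θ θ̄' + τ ∫ q q̄'`. -/
def form (U V : PhaseSpace B) : ℂ :=
  wform B.p (dx0 B.L (u U)) (dx0 B.L (u V)) + wform B.m (w U) (w V)
    + wform (fun _ => 1) (θ U) (θ V) + B.τ * wform (fun _ => 1) (q U) (q V)

lemma form_bounds (B : Beam) : ∃ c C : ℝ, 0 < c ∧ 0 < C ∧ ∀ U : PhaseSpace B,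
    c * (‖dx0 B.L (u U)‖ ^ 2 + ‖w U‖ ^ 2 + ‖θ U‖ ^ 2 + ‖q U‖ ^ 2) ≤ (form U U).re ∧
    (form U U).re ≤ C * (‖dx0 B.L (u U)‖ ^ 2 + ‖w U‖ ^ 2 + ‖θ U‖ ^ 2 + ‖q U‖ ^ 2) := by
  obtain ⟨c1, C1, hc1, hC1, h1⟩ := wform_bounds B.L_pos B.p_cont B.p_pos
  obtain ⟨c2, C2, hc2, hC2, h2⟩ := wform_bounds B.L_pos B.m_cont B.m_pos
  have h3 : ∀ f : L2 B.L, (wform (fun _ => 1) f f).re = ‖f‖ ^ 2 := fun f => by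
    rw [wform_self, Complex.ofReal_re, ← integral_norm_sq]
    simp
  refine ⟨min (min c1 c2) (min 1 B.τ), max (max C1 C2) (max 1 B.τ), ?_, ?_, fun U => ?_⟩
  · exact lt_min (lt_min hc1 hc2) (lt_min one_pos B.τ_pos)
  · exact lt_max_of_lt_left (lt_max_of_lt_left hC1)
  have e : (form U U).re = (wform B.p (dx0 B.L (u U)) (dx0 B.L (u U))).re
      + (wform B.m (w U) (w U)).re + ‖θ U‖ ^ 2 + B.τ * ‖q U‖ ^ 2 := by
    rw [form, Complex.add_re, Complex.add_re, Complex.add_re, Complex.re_ofReal_mul, h3, h3]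
  rw [e]
  have hp := h1 (dx0 B.L (u U))
  have hm := h2 (w U)
  have n1 := sq_nonneg ‖dx0 B.L (u U)‖
  have n2 := sq_nonneg ‖w U‖
  have n3 := sq_nonneg ‖θ U‖
  have n4 := sq_nonneg ‖q U‖
  constructor
  · have a1 : min (min c1 c2) (min 1 B.τ) ≤ c1 := (min_le_left _ _).trans (min_le_left _ _)
    have a2 : min (min c1 c2) (min 1 B.τ) ≤ c2 := (min_le_left _ _).trans (min_le_right _ _)
    have a3 : min (min c1 c2) (min 1 B.τ) ≤ 1 := (min_le_right _ _).trans (min_le_left _ _)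
    have a4 : min (min c1 c2) (min 1 B.τ) ≤ B.τ := (min_le_right _ _).trans (min_le_right _ _)
    linarith [mul_le_mul_of_nonneg_right a1 n1, mul_le_mul_of_nonneg_right a2 n2,
      mul_le_mul_of_nonneg_right a3 n3, mul_le_mul_of_nonneg_right a4 n4, hp.1, hm.1]
  · have a1 : C1 ≤ max (max C1 C2) (max 1 B.τ) := (le_max_left _ _).trans (le_max_left _ _)
    have a2 : C2 ≤ max (max C1 C2) (max 1 B.τ) := (le_max_right _ _).trans (le_max_left _ _)
    have a3 : 1 ≤ max (max C1 C2) (max 1 B.τ) := (le_max_left _ _).trans (le_max_right _ _)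
    have a4 : B.τ ≤ max (max C1 C2) (max 1 B.τ) := (le_max_right _ _).trans (le_max_right _ _)
    linarith [mul_le_mul_of_nonneg_right a1 n1, mul_le_mul_of_nonneg_right a2 n2,
      mul_le_mul_of_nonneg_right a3 n3, mul_le_mul_of_nonneg_right a4 n4, hp.2, hm.2]

/-- `⟪U, V⟫ = form V U`, because Mathlib's inner products are conjugate linear in the first
argument. -/
@[reducible]
def core (B : Beam) : InnerProductSpace.Core ℂ (PhaseSpace B) where
  inner U V := form V U
  conj_inner_symm U V := by
    simp only [form, map_add, map_mul, wform_conj, Complex.conj_ofReal]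
  re_inner_nonneg U := by
    obtain ⟨c, C, hc, hC, h⟩ := form_bounds B
    exact le_trans (by positivity) (h U).1
  add_left U V W := by
    simp only [form, map_add, wform_eq_inner B.p_cont, wform_eq_inner B.m_cont,
      wform_eq_inner (a := fun _ => 1) continuousOn_const, inner_add_left]
    ring
  smul_left U V r := by
    simp only [form, map_smul, wform_eq_inner B.p_cont, wform_eq_inner B.m_cont,
      wform_eq_inner (a := fun _ => 1) continuousOn_const, inner_smul_left]
    ring
  definite U hU := by
    obtain ⟨c, C, hc, hC, h⟩ := form_bounds B
    have h1 := (h U).1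
    have h2 : (form U U).re = 0 := by
      rw [show form U U = 0 from hU, Complex.zero_re]
    rw [h2] at h1
    have n1 := sq_nonneg ‖dx0 B.L (u U)‖
    have n2 := sq_nonneg ‖w U‖
    have n3 := sq_nonneg ‖θ U‖
    have n4 := sq_nonneg ‖q U‖
    have h3 := nonpos_of_mul_nonpos_right h1 hc
    have z1 : ‖dx0 B.L (u U)‖ = 0 := pow_eq_zero_iff (two_ne_zero) |>.mp (by linarith)
    have z2 : ‖w U‖ = 0 := pow_eq_zero_iff (two_ne_zero) |>.mp (by linarith)
    have z3 : ‖θ U‖ = 0 := pow_eq_zero_iff (two_ne_zero) |>.mp (by linarith)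
    have z4 : ‖q U‖ = 0 := pow_eq_zero_iff (two_ne_zero) |>.mp (by linarith)
    have hu := poincare B.L_pos.le (u U)
    rw [z1, mul_zero] at hu
    have hu' : u U = 0 := Subtype.ext (norm_le_zero_iff.mp hu)
    refine ext' ?_ ?_ ?_ ?_
    · rw [hu', map_zero]
    · rw [norm_eq_zero.mp z2, map_zero]
    · rw [norm_eq_zero.mp z3, map_zero]
    · rw [norm_eq_zero.mp z4, map_zero]

instance : NormedAddCommGroup (PhaseSpace B) := (core B).toNormedAddCommGroup

instance : InnerProductSpace ℂ (PhaseSpace B) := InnerProductSpace.ofCore (core B).toCore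

lemma inner_eq (U V : PhaseSpace B) : inner ℂ U V = form V U := rfl

lemma norm_sq_eq (U : PhaseSpace B) : ‖U‖ ^ 2 = (form U U).re := by
  rw [← inner_eq, ← inner_self_eq_norm_sq (𝕜 := ℂ)]
  rfl

instance : CompleteSpace (PhaseSpace B) := by
  obtain ⟨c, C, hc, hC, h⟩ := form_bounds B
  have hcs : ∀ (f : PhaseSpace B →ₗ[ℂ] L2 B.L), (∀ U, c * ‖f U‖ ^ 2 ≤ ‖U‖ ^ 2) →
      ∀ V : ℕ → PhaseSpace B, CauchySeq V → CauchySeq fun n => f (V n) := by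
    intro f hf V hV
    have hb : ∀ U, ‖f U‖ ≤ (Real.sqrt c)⁻¹ * ‖U‖ := fun U => by
      rw [inv_mul_eq_div, le_div_iff₀ (Real.sqrt_pos.mpr hc)]
      refine abs_le_of_sq_le_sq' ?_ (norm_nonneg U) |>.2
      rw [mul_pow, Real.sq_sqrt hc.le, mul_comm]
      exact hf U
    exact (f.mkContinuous _ hb).uniformContinuous.comp_cauchySeq hV
  have hlow : ∀ U : PhaseSpace B, c * ‖dx0 B.L (u U)‖ ^ 2 + c * ‖w U‖ ^ 2 + c * ‖θ U‖ ^ 2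
      + c * ‖q U‖ ^ 2 ≤ ‖U‖ ^ 2 := fun U => by
    rw [norm_sq_eq]
    linarith [(h U).1]
  have hn : ∀ x : ℝ, 0 ≤ c * x ^ 2 := fun x => by positivity
  refine Metric.complete_of_cauchySeq_tendsto fun V hV => ?_
  have c1 := hcs (dx0 B.L ∘ₗ u) (fun U => by
    have := hlow U
    simp only [LinearMap.comp_apply]
    linarith [hn ‖w U‖, hn ‖θ U‖, hn ‖q U‖]) V hV
  have c2 := hcs w (fun U => by
    linarith [hlow U, hn ‖dx0 B.L (u U)‖, hn ‖θ U‖, hn ‖q U‖]) V hV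
  have c3 := hcs θ (fun U => by
    linarith [hlow U, hn ‖dx0 B.L (u U)‖, hn ‖w U‖, hn ‖q U‖]) V hV
  have c4 := hcs q (fun U => by
    linarith [hlow U, hn ‖dx0 B.L (u U)‖, hn ‖w U‖, hn ‖θ U‖]) V hV
  have c0 : CauchySeq fun n => ((u (V n) : H10 B.L) : L2 B.L) := by
    rw [Metric.cauchySeq_iff'] at c1 ⊢
    intro ε hε
    obtain ⟨N, hN⟩ := c1 (ε / B.L) (div_pos hε B.L_pos)
    refine ⟨N, fun n hn => ?_⟩
    have h1 := poincare B.L_pos.le (u (V n) - u (V N))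
    have h2 := hN n hn
    rw [dist_eq_norm, lt_div_iff₀ B.L_pos] at h2
    simp only [LinearMap.comp_apply] at h2
    rw [map_sub] at h1
    rw [dist_eq_norm, ← Submodule.coe_sub]
    linarith
  obtain ⟨l0, h0⟩ := cauchySeq_tendsto_of_complete c0
  obtain ⟨l1, h1⟩ := cauchySeq_tendsto_of_complete c1
  obtain ⟨l2, h2⟩ := cauchySeq_tendsto_of_complete c2
  obtain ⟨l3, h3⟩ := cauchySeq_tendsto_of_complete c3
  obtain ⟨l4, h4⟩ := cauchySeq_tendsto_of_complete c4
  have hmem : ((l0, l1) : L2 B.L × L2 B.L) ∈ (testGraph B.L).topologicalClosure :=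
    (testGraph B.L).isClosed_topologicalClosure.mem_of_tendsto (h0.prodMk_nhds h1)
      (Filter.Eventually.of_forall fun n => dx0_mem (u (V n)))
  have hl0 : l0 ∈ H10 B.L := ⟨(l0, l1), hmem, rfl⟩
  have hdx : dx0 B.L ⟨l0, hl0⟩ = l1 := dx_eq (closure_testGraph_le hmem) (H10_le_H1 hl0)
  refine ⟨mk ⟨l0, hl0⟩ l2 l3 l4, ?_⟩
  have g : Filter.Tendsto (fun n => C * (‖dx0 B.L (u (V n)) - l1‖ ^ 2 + ‖w (V n) - l2‖ ^ 2
      + ‖θ (V n) - l3‖ ^ 2 + ‖q (V n) - l4‖ ^ 2)) Filter.atTop (nhds 0) := by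
    have e1 := (tendsto_iff_norm_sub_tendsto_zero.mp h1).pow 2
    have e2 := (tendsto_iff_norm_sub_tendsto_zero.mp h2).pow 2
    have e3 := (tendsto_iff_norm_sub_tendsto_zero.mp h3).pow 2
    have e4 := (tendsto_iff_norm_sub_tendsto_zero.mp h4).pow 2
    simpa using (((e1.add e2).add e3).add e4).const_mul C
  rw [tendsto_iff_norm_sub_tendsto_zero]
  have g2 : Filter.Tendsto (fun n => ‖V n - mk ⟨l0, hl0⟩ l2 l3 l4‖ ^ 2) Filter.atTop
      (nhds 0) := by
    refine squeeze_zero (fun n => by positivity) (fun n => ?_) g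
    have := (h (V n - mk ⟨l0, hl0⟩ l2 l3 l4)).2
    rw [← norm_sq_eq] at this
    simpa only [map_sub, u_mk, w_mk, θ_mk, q_mk, hdx] using this
  have g3 := g2.sqrt
  simpa using g3

end PhaseSpace

/-! ### The operators -/

/-- The two sets of boundary conditions (besides `u = 0`): `θ = 0`, or `q = 0`, at both ends. -/
inductive Boundary
  | temperature
  | flux

/-- The space prescribed for `θ`. -/
def Boundary.θSpace (L : ℝ) : Boundary → Submodule ℂ (L2 L)
  | temperature => H10 L
  | flux => H1 L

/-- The space prescribed for `q`. -/
def Boundary.qSpace (L : ℝ) : Boundary → Submodule ℂ (L2 L)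
  | temperature => H1 L
  | flux => H10 L

lemma Boundary.θSpace_le (L : ℝ) (bc : Boundary) : bc.θSpace L ≤ H1 L := by
  cases bc
  · exact H10_le_H1
  · exact le_rfl

lemma Boundary.qSpace_le (L : ℝ) (bc : Boundary) : bc.qSpace L ≤ H1 L := by
  cases bc
  · exact le_rfl
  · exact H10_le_H1

section Operator

open PhaseSpace

variable (B : Beam) (bc : Boundary)

/-- `p u_x + 2 δ w_x`. -/
def stress (v w : H10 B.L) : L2 B.L :=
  mulL2 B.p B.p_cont (dx0 B.L v) + (2 : ℂ) • mulL2 B.δ B.δ_cont (dx0 B.L w)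

lemma stress_add (v v' w w' : H10 B.L) :
    stress B (v + v') (w + w') = stress B v w + stress B v' w' := by
  simp only [stress, map_add, smul_add]
  abel

lemma stress_smul (c : ℂ) (v w : H10 B.L) : stress B (c • v) (c • w) = c • stress B v w := by
  simp only [stress, map_smul, smul_add, smul_comm c]

/-- The domain `𝒟₁` (for `Boundary.temperature`) or `𝒟₂` (for `Boundary.flux`). -/
def opDomain : Submodule ℂ (PhaseSpace B) where
  carrier := {U | (∃ hw : w U ∈ H10 B.L, stress B (u U) ⟨w U, hw⟩ ∈ H1 B.L) ∧
    θ U ∈ bc.θSpace B.L ∧ q U ∈ bc.qSpace B.L}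
  zero_mem' := by
    refine ⟨⟨by simp, ?_⟩, by simp, by simp⟩
    have h := stress_smul B 0 0 0
    rw [zero_smul, zero_smul] at h
    change stress B 0 0 ∈ H1 B.L
    rw [h]
    exact zero_mem _
  add_mem' := by
    rintro U V ⟨⟨hw, hs⟩, hθ, hq⟩ ⟨⟨hw', hs'⟩, hθ', hq'⟩
    refine ⟨⟨by simpa using add_mem hw hw', ?_⟩, by simpa using add_mem hθ hθ',
      by simpa using add_mem hq hq'⟩
    have := add_mem hs hs'
    rw [← stress_add] at this
    simpa using this
  smul_mem' := by
    rintro c U ⟨⟨hw, hs⟩, hθ, hq⟩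
    refine ⟨⟨by simpa using Submodule.smul_mem _ c hw, ?_⟩,
      by simpa using Submodule.smul_mem _ c hθ, by simpa using Submodule.smul_mem _ c hq⟩
    have := Submodule.smul_mem _ c hs
    rw [← stress_smul] at this
    simpa using this

variable {B bc}

/-- The component `w` of an element of the domain, as an element of `H¹₀`. -/
def w0 : opDomain B bc →ₗ[ℂ] H10 B.L where
  toFun U := ⟨w (U : PhaseSpace B), U.2.1.1⟩
  map_add' _ _ := rfl
  map_smul' _ _ := rfl

/-- The component `θ` of an element of the domain, as an element of `H¹`. -/
def θ1 : opDomain B bc →ₗ[ℂ] H1 B.L where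
  toFun U := ⟨θ (U : PhaseSpace B), bc.θSpace_le _ U.2.2.1⟩
  map_add' _ _ := rfl
  map_smul' _ _ := rfl

/-- The component `q` of an element of the domain, as an element of `H¹`. -/
def q1 : opDomain B bc →ₗ[ℂ] H1 B.L where
  toFun U := ⟨q (U : PhaseSpace B), bc.qSpace_le _ U.2.2.2⟩
  map_add' _ _ := rfl
  map_smul' _ _ := rfl

/-- `p u_x + 2 δ w_x` for an element of the domain, as an element of `H¹`. -/
def stress1 : opDomain B bc →ₗ[ℂ] H1 B.L where
  toFun U := ⟨stress B (u (U : PhaseSpace B)) (w0 U), U.2.1.2⟩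
  map_add' U V := Subtype.ext (by
    simp [stress_add])
  map_smul' c U := Subtype.ext (by
    simp [stress_smul])

lemma inv_m_cont (B : Beam) : ContinuousOn (fun x => 1 / B.m x) (Icc 0 B.L) :=
  continuousOn_const.div B.m_cont fun x hx => (B.m_pos x hx).ne'

/-- `A U = (w, m⁻¹ (p u_x + 2 δ w_x - η θ)_x, -κ q_x - η w_x, -τ⁻¹ (κ θ_x + β q))`. -/
def opFun (U : opDomain B bc) : PhaseSpace B :=
  mk (w0 U)
    (mulL2 (fun x => 1 / B.m x) (inv_m_cont B) (dx B.L (stress1 U - (B.η : ℂ) • θ1 U)))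
    (-((B.κ : ℂ) • dx B.L (q1 U)) - (B.η : ℂ) • dx0 B.L (w0 U))
    ((-1 / B.τ : ℂ) • ((B.κ : ℂ) • dx B.L (θ1 U) + (B.β : ℂ) • q (U : PhaseSpace B)))

variable (B bc)

/-- The operator `𝒜` with domain `𝒟₁` or `𝒟₂`, as an unbounded operator on the phase space. -/
def op : PhaseSpace B →ₗ.[ℂ] PhaseSpace B where
  domain := opDomain B bc
  toFun :=
    { toFun := opFun
      map_add' := fun U V => by
        refine ext' ?_ ?_ ?_ ?_
        · simp only [map_add, opFun, u_mk]
        · simp only [map_add, map_sub, map_smul, opFun, w_mk]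
          module
        · simp only [map_add, opFun, θ_mk]
          module
        · simp only [map_add, opFun, q_mk, Submodule.coe_add]
          module
      map_smul' := fun c U => by
        refine ext' ?_ ?_ ?_ ?_
        · simp only [map_smul, opFun, u_mk, RingHom.id_apply]
        · simp only [map_smul, map_sub, opFun, w_mk, RingHom.id_apply]
          module
        · simp only [map_smul, opFun, θ_mk, RingHom.id_apply]
          module
        · simp only [map_smul, opFun, q_mk, Submodule.coe_smul, RingHom.id_apply]
          module }

end Operator

/-! ### Abstract Cauchy problems -/

section Cauchy

variable {E : Type*} [NormedAddCommGroup E] [NormedSpace ℂ E]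

/-- `U ∈ C([0, ∞); E)` is a mild solution of `U' = A U`, `U(0) = U₀`: for all `t ≥ 0`,
`∫₀ᵗ U(s) ds` lies in the domain of `A` and `U(t) = U₀ + A ∫₀ᵗ U(s) ds`. -/
def IsMildSolution (A : E →ₗ.[ℂ] E) (U₀ : E) (U : C(ℝ≥0, E)) : Prop :=
  ∀ t : ℝ≥0, ∃ h : (∫ s in (0 : ℝ)..t, U s.toNNReal) ∈ A.domain, U t = U₀ + A ⟨_, h⟩

/-- `U ∈ C¹([0, ∞); E)`. -/
def IsC1 (U : ℝ≥0 → E) : Prop := ContDiffOn ℝ 1 (fun s : ℝ => U s.toNNReal) (Ici 0)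

/-- `U ∈ C([0, ∞); D(A))`, where `D(A)` carries the graph norm. -/
def IsContInDomain (A : E →ₗ.[ℂ] E) (U : ℝ≥0 → E) : Prop :=
  ∃ h : ∀ t, U t ∈ A.domain, Continuous fun t => ((U t, A ⟨U t, h t⟩) : E × E)

/-- `U(t) ∈ D(A)` and `U'(t) = A U(t)` for all `t ≥ 0` (one-sided derivative at `0`), and
`U(0) = U₀`. -/
def IsStrongSolution (A : E →ₗ.[ℂ] E) (U₀ : E) (U : ℝ≥0 → E) : Prop :=
  U 0 = U₀ ∧ ∀ t : ℝ≥0, ∃ h : U t ∈ A.domain,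
    HasDerivWithinAt (fun s : ℝ => U s.toNNReal) (A ⟨U t, h⟩) (Ici 0) t

end Cauchy

end Cattaneo

end

/- The operator `𝒜` is maximal dissipative, so the theorem is the Lumer–Phillips theorem: the groups
generated by the bounded Yosida approximations of `𝒜` converge, by Kato's estimate, to a contraction
semigroup whose orbits are the mild solutions.

Dissipativity is the energy identity `Re ⟨U, 𝒜 U⟩ = -2 ∫ δ |w_x|² - β ‖q‖²`. For the range
condition, eliminate `u` and take the total stress `-σ = p u_x + 2 δ w_x - η θ` as an unknown. In
`(w, σ, θ, q)` the equation `U - c 𝒜 U = F` is a bounded coercive operator plus the first-order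
relation pairing `w_x` with `σ_x` and `θ_x` with `q_x`. Under both boundary conditions this relation
is skew-adjoint, because the derivative on `H¹₀` is minus the adjoint of the derivative on `H¹`; and
a skew-adjoint relation plus a bounded coercive operator is onto. -/

open MeasureTheory Set Filter Topology
open scoped ContDiff ComplexConjugate NNReal ENNReal

noncomputable section

namespace Cattaneo

lemma uniformCauchySeqOn_of_dense {ι α X Y : Type*} [PseudoMetricSpace X] [PseudoMetricSpace Y]
    {l : Filter ι} {s : Set α} {D : Set X} {T : ι → α → X → Y}
    (hT : ∀ i, ∀ a ∈ s, LipschitzWith 1 (T i a)) (hD : Dense D)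
    (h : ∀ x ∈ D, UniformCauchySeqOn (fun i a => T i a x) l s) (x : X) :
    UniformCauchySeqOn (fun i a => T i a x) l s := by
  intro u hu
  obtain ⟨ε, hε, hεu⟩ := Metric.mem_uniformity_dist.mp hu
  obtain ⟨y, hy, hxy⟩ := Metric.mem_closure_iff.mp (hD x) (ε / 3) (by positivity)
  have hclose : ∀ i, ∀ a ∈ s, dist (T i a x) (T i a y) < ε / 3 := fun i a ha =>
    ((hT i a ha).dist_le_mul x y).trans_lt (by simpa using hxy)
  filter_upwards [h y hy _ (Metric.dist_mem_uniformity (show 0 < ε / 3 by positivity))]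
    with ij hij a ha
  have htri := dist_triangle4 (T ij.1 a x) (T ij.1 a y) (T ij.2 a y) (T ij.2 a x)
  have hmid : dist (T ij.1 a y) (T ij.2 a y) < ε / 3 := hij a ha
  have hright := hclose ij.2 a ha
  rw [dist_comm] at hright
  exact hεu (by linarith [hclose ij.1 a ha])

lemma tendsto_coe_Ioi_atBot : Tendsto (fun c : Ioi (0 : ℝ) => (c : ℝ)) atBot (𝓝 0) :=
  (tendsto_comp_coe_Ioi_atBot (f := id)).mpr (tendsto_id'.mpr nhdsWithin_le_nhds)

lemma continuous_comp_toNNReal {X : Type*} [TopologicalSpace X] (U : C(ℝ≥0, X)) :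
    Continuous fun s : ℝ => U s.toNNReal :=
  U.continuous.comp continuous_real_toNNReal

section MildSolution

variable {E : Type*} [NormedAddCommGroup E] [NormedSpace ℂ E]

lemma isMildSolution_iff_mem_graph {A : E →ₗ.[ℂ] E} {x : E} {U : C(ℝ≥0, E)} :
    IsMildSolution A x U ↔
      ∀ t : ℝ≥0, (∫ s in (0 : ℝ)..t, U s.toNNReal, U t - x) ∈ A.graph := by
  simp only [IsMildSolution, LinearPMap.mem_graph_iff, Subtype.exists, exists_and_left,
    exists_eq_left, eq_sub_iff_add_eq', eq_comm (a := U _)]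

variable [CompleteSpace E] (U : C(ℝ≥0, E))

lemma hasDerivAt_integral_toNNReal (t : ℝ) :
    HasDerivAt (fun t => ∫ s in (0 : ℝ)..t, U s.toNNReal) (U t.toNNReal) t :=
  ((continuous_comp_toNNReal U).integral_hasStrictDerivAt 0 t).hasDerivAt

/-- The primitive `t ↦ x + ∫₀ᵗ U` of `U` with value `x` at `0`. -/
def primitive (x : E) : C(ℝ≥0, E) where
  toFun t := x + ∫ s in (0 : ℝ)..t, U s.toNNReal
  continuous_toFun := by
    have h : Continuous fun t : ℝ => ∫ s in (0 : ℝ)..t, U s.toNNReal :=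
      continuous_iff_continuousAt.mpr fun t => (hasDerivAt_integral_toNNReal U t).continuousAt
    exact continuous_const.add (h.comp NNReal.continuous_coe)

lemma hasDerivWithinAt_primitive (x : E) {t : ℝ} (ht : 0 ≤ t) :
    HasDerivWithinAt (fun s : ℝ => primitive U x s.toNNReal) (U t.toNNReal) (Ici 0) t := by
  have heq : ∀ s ∈ Ici (0 : ℝ),
      primitive U x s.toNNReal = x + ∫ r in (0 : ℝ)..s, U r.toNNReal := fun s hs => by
    rw [primitive, ContinuousMap.coe_mk, Real.coe_toNNReal s hs]
  exact ((hasDerivAt_integral_toNNReal U t).const_add x).hasDerivWithinAt.congr heq (heq t ht)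

lemma isC1_primitive (x : E) : IsC1 (primitive U x) := by
  rw [IsC1, contDiffOn_one_iff_derivWithin (uniqueDiffOn_Ici 0)]
  refine ⟨fun t ht => (hasDerivWithinAt_primitive U x ht).differentiableWithinAt, ?_⟩
  exact (continuous_comp_toNNReal U).continuousOn.congr fun t ht =>
    (hasDerivWithinAt_primitive U x ht).derivWithin (uniqueDiffOn_Ici 0 t ht)

lemma primitive_mem_graph {A : E →ₗ.[ℂ] E} {x y : E} (hxy : (x, y) ∈ A.graph) {W : C(ℝ≥0, E)}
    (hW : IsMildSolution A y W) (t : ℝ≥0) : (primitive W x t, W t) ∈ A.graph := by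
  have h := add_mem hxy (isMildSolution_iff_mem_graph.mp hW t)
  rwa [Prod.mk_add_mk, add_sub_cancel] at h

end MildSolution

section Dissipative

variable {E : Type*} [NormedAddCommGroup E] [InnerProductSpace ℂ E]

/-- Maximal dissipative operators, the generators of contraction semigroups on a Hilbert space.
The range condition is required for every `c > 0`, where one value of `c` would be equivalent. -/
structure IsMaximalDissipative (A : E →ₗ.[ℂ] E) : Prop where
  re_inner_nonpos : ∀ x : A.domain, (inner ℂ (x : E) (A x)).re ≤ 0
  exists_sub_smul_eq : ∀ c : ℝ, 0 < c → ∀ y : E, ∃ x : A.domain, (x : E) - (c : ℂ) • A x = y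

lemma re_inner_self (x : E) : (inner ℂ x x).re = ‖x‖ ^ 2 :=
  inner_self_eq_norm_sq (𝕜 := ℂ) x

lemma norm_sq_le_of_re_inner_le {f f' : ℝ → E} {K t : ℝ}
    (hf : ∀ s ∈ Ici (0 : ℝ), HasDerivAt f (f' s) s)
    (hK : ∀ s ∈ Ici (0 : ℝ), (inner ℂ (f s) (f' s)).re ≤ K) (ht : 0 ≤ t) :
    ‖f t‖ ^ 2 ≤ ‖f 0‖ ^ 2 + 2 * K * t := by
  let _ : InnerProductSpace ℝ E := InnerProductSpace.complexToReal
  have hd : ∀ s ∈ Ici (0 : ℝ), HasDerivAt (fun s => ‖f s‖ ^ 2 - 2 * K * s)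
      (2 * (inner ℂ (f s) (f' s)).re - 2 * K * 1) s := fun s hs =>
    (hf s hs).norm_sq.sub ((hasDerivAt_id s).const_mul (2 * K))
  have hanti : AntitoneOn (fun s => ‖f s‖ ^ 2 - 2 * K * s) (Ici 0) :=
    antitoneOn_of_hasDerivWithinAt_nonpos (convex_Ici 0)
      (fun s hs => (hd s hs).continuousAt.continuousWithinAt)
      (fun s hs => (hd s (interior_subset hs)).hasDerivWithinAt)
      fun s hs => by linarith [hK s (interior_subset hs)]
  have := hanti self_mem_Ici ht ht
  simp only [mul_zero, sub_zero] at this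
  linarith

namespace IsMaximalDissipative

variable {A : E →ₗ.[ℂ] E}

lemma re_inner_nonpos_of_mem_graph (hA : IsMaximalDissipative A) {x y : E}
    (h : (x, y) ∈ A.graph) : (inner ℂ x y).re ≤ 0 := by
  obtain ⟨z, rfl, rfl⟩ := (LinearPMap.mem_graph_iff A).mp h
  exact hA.re_inner_nonpos z

lemma norm_le_norm_sub_smul (hA : IsMaximalDissipative A) {c : ℝ} (hc : 0 < c) (x : A.domain) :
    ‖(x : E)‖ ≤ ‖(x : E) - (c : ℂ) • A x‖ := by
  have hre : ‖(x : E)‖ ^ 2 ≤ (inner ℂ (x : E) ((x : E) - (c : ℂ) • A x)).re := by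
    rw [inner_sub_right, inner_smul_right, Complex.sub_re, Complex.re_ofReal_mul,
      re_inner_self]
    linarith [mul_nonpos_of_nonneg_of_nonpos hc.le (hA.re_inner_nonpos x)]
  have hmul : ‖(x : E)‖ * ‖(x : E)‖ ≤ ‖(x : E)‖ * ‖(x : E) - (c : ℂ) • A x‖ := by
    rw [← sq]
    exact hre.trans ((Complex.re_le_norm _).trans (norm_inner_le_norm _ _))
  rcases (norm_nonneg (x : E)).eq_or_lt with h0 | h0
  · exact h0 ▸ norm_nonneg _
  · exact le_of_mul_le_mul_left hmul h0

/-- The map `x ↦ x - c A x` from the domain onto the whole space. -/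
def subSMulEquiv (hA : IsMaximalDissipative A) (c : Ioi (0 : ℝ)) : A.domain ≃ₗ[ℂ] E :=
  LinearEquiv.ofBijective (A.domain.subtype - ((c : ℝ) : ℂ) • A.toFun)
    ⟨(injective_iff_map_eq_zero _).mpr fun x hx => by
      have h : ‖(x : E)‖ ≤ ‖(0 : E)‖ := (hA.norm_le_norm_sub_smul c.2 x).trans_eq (congrArg _ hx)
      exact Subtype.ext (norm_le_zero_iff.mp (h.trans_eq norm_zero)),
    hA.exists_sub_smul_eq c c.2⟩

lemma subSMulEquiv_apply (hA : IsMaximalDissipative A) (c : Ioi (0 : ℝ)) (x : A.domain) :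
    hA.subSMulEquiv c x = x - ((c : ℝ) : ℂ) • A x := rfl

/-- The resolvent `(1 - c A)⁻¹`. -/
def resolvent (hA : IsMaximalDissipative A) (c : Ioi (0 : ℝ)) : E →L[ℂ] E :=
  (A.domain.subtype ∘ₗ (hA.subSMulEquiv c).symm.toLinearMap).mkContinuous 1 fun y => by
    have h := hA.norm_le_norm_sub_smul c.2 ((hA.subSMulEquiv c).symm y)
    rwa [← subSMulEquiv_apply hA c, LinearEquiv.apply_symm_apply, ← one_mul ‖y‖] at h

lemma norm_resolvent_le (hA : IsMaximalDissipative A) (c : Ioi (0 : ℝ)) (y : E) :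
    ‖hA.resolvent c y‖ ≤ ‖y‖ := by
  simpa using (hA.resolvent c).le_of_opNorm_le (LinearMap.mkContinuous_norm_le _ zero_le_one _) y

lemma mem_graph_iff (hA : IsMaximalDissipative A) (c : Ioi (0 : ℝ)) {x y : E} :
    (x, y) ∈ A.graph ↔ hA.resolvent c (x - ((c : ℝ) : ℂ) • y) = x := by
  have hc : ((c : ℝ) : ℂ) ≠ 0 := by exact_mod_cast c.2.ne'
  rw [LinearPMap.mem_graph_iff]
  constructor
  · rintro ⟨z, rfl, rfl⟩
    rw [← hA.subSMulEquiv_apply c]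
    exact congrArg Subtype.val ((hA.subSMulEquiv c).symm_apply_apply z)
  · intro h
    have hz := (hA.subSMulEquiv c).apply_symm_apply (x - ((c : ℝ) : ℂ) • y)
    have hx : (((hA.subSMulEquiv c).symm (x - ((c : ℝ) : ℂ) • y) : A.domain) : E) = x := h
    rw [subSMulEquiv_apply, hx] at hz
    exact ⟨_, hx, smul_right_injective E hc (sub_right_injective hz)⟩

lemma mem_graph_of_tendsto (hA : IsMaximalDissipative A) {ι : Type*} {l : Filter ι} [l.NeBot]
    {f g : ι → E} {x y : E} (hfg : ∀ i, (f i, g i) ∈ A.graph) (hf : Tendsto f l (𝓝 x))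
    (hg : Tendsto g l (𝓝 y)) : (x, y) ∈ A.graph := by
  let c : Ioi (0 : ℝ) := ⟨1, mem_Ioi.mpr one_pos⟩
  rw [hA.mem_graph_iff c]
  refine tendsto_nhds_unique
    (((hA.resolvent c).continuous.tendsto _).comp (hf.sub (hg.const_smul _))) (hf.congr fun i => ?_)
  exact ((hA.mem_graph_iff c).mp (hfg i)).symm

lemma integral_mem_graph (hA : IsMaximalDissipative A) [CompleteSpace E] {f g : ℝ → E}
    (hf : Continuous f) (hg : Continuous g) {a b : ℝ} (hab : a ≤ b)
    (hfg : ∀ s ∈ Icc a b, (f s, g s) ∈ A.graph) :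
    (∫ s in a..b, f s, ∫ s in a..b, g s) ∈ A.graph := by
  let c : Ioi (0 : ℝ) := ⟨1, mem_Ioi.mpr one_pos⟩
  have hg' : Continuous fun s => ((c : ℝ) : ℂ) • g s := hg.const_smul _
  have hfg' : Continuous fun s => f s - ((c : ℝ) : ℂ) • g s := hf.sub hg'
  rw [hA.mem_graph_iff c, ← intervalIntegral.integral_smul,
    ← intervalIntegral.integral_sub (hf.intervalIntegrable _ _) (hg'.intervalIntegrable _ _),
    ← ContinuousLinearMap.intervalIntegral_comp_comm (hA.resolvent c)
      (hfg'.intervalIntegrable _ _)]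
  refine intervalIntegral.integral_congr fun s hs => ?_
  rw [uIcc_of_le hab] at hs
  exact (hA.mem_graph_iff c).mp (hfg s hs)

lemma dense_domain (hA : IsMaximalDissipative A) [CompleteSpace E] :
    Dense (A.domain : Set E) := by
  rw [Submodule.dense_iff_topologicalClosure_eq_top, Submodule.topologicalClosure_eq_top_iff,
    Submodule.eq_bot_iff]
  intro z hz
  obtain ⟨x, rfl⟩ := hA.exists_sub_smul_eq 1 one_pos z
  have hre := congrArg Complex.re (hz x x.2)
  rw [Complex.ofReal_one, one_smul, inner_sub_right, Complex.sub_re,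
    re_inner_self, Complex.zero_re] at hre
  have hx : ‖(x : E)‖ ^ 2 ≤ 0 := by linarith [hA.re_inner_nonpos x]
  have hx0 : x = 0 := Subtype.ext (by simpa using hx.antisymm (sq_nonneg _))
  rw [hx0, A.map_zero, Submodule.coe_zero, smul_zero, sub_zero]

/-- The Yosida approximation `A (1 - c A)⁻¹`, written as `c⁻¹ ((1 - c A)⁻¹ - 1)`. -/
def yosida (hA : IsMaximalDissipative A) (c : Ioi (0 : ℝ)) : E →L[ℂ] E :=
  ((c : ℝ) : ℂ)⁻¹ • (hA.resolvent c - ContinuousLinearMap.id ℂ E)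

lemma smul_yosida (hA : IsMaximalDissipative A) (c : Ioi (0 : ℝ)) (x : E) :
    ((c : ℝ) : ℂ) • hA.yosida c x = hA.resolvent c x - x :=
  smul_inv_smul₀ (by exact_mod_cast c.2.ne') _

lemma resolvent_yosida_mem_graph (hA : IsMaximalDissipative A) (c : Ioi (0 : ℝ)) (x : E) :
    (hA.resolvent c x, hA.yosida c x) ∈ A.graph := by
  rw [hA.mem_graph_iff c, smul_yosida, sub_sub_cancel]

lemma yosida_eq_resolvent (hA : IsMaximalDissipative A) (c : Ioi (0 : ℝ)) {x y : E}
    (h : (x, y) ∈ A.graph) : hA.yosida c x = hA.resolvent c y := by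
  have hx := (hA.mem_graph_iff c).mp h
  rw [map_sub, map_smul, sub_eq_iff_eq_add, ← sub_eq_iff_eq_add', ← smul_yosida] at hx
  exact smul_right_injective E (by exact_mod_cast c.2.ne' : ((c : ℝ) : ℂ) ≠ 0) hx

lemma re_inner_resolvent_sub_nonpos (hA : IsMaximalDissipative A) (c d : Ioi (0 : ℝ)) (x y : E) :
    (inner ℂ (hA.resolvent c x - hA.resolvent d y) (hA.yosida c x - hA.yosida d y)).re ≤ 0 :=
  hA.re_inner_nonpos_of_mem_graph
    (sub_mem (hA.resolvent_yosida_mem_graph c x) (hA.resolvent_yosida_mem_graph d y))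

lemma re_inner_yosida_nonpos (hA : IsMaximalDissipative A) (c : Ioi (0 : ℝ)) (x : E) :
    (inner ℂ x (hA.yosida c x)).re ≤ 0 := by
  have hJ := hA.re_inner_nonpos_of_mem_graph (hA.resolvent_yosida_mem_graph c x)
  have hx : x = hA.resolvent c x - ((c : ℝ) : ℂ) • hA.yosida c x := by
    rw [smul_yosida, sub_sub_cancel]
  have hsq : 0 ≤ (c : ℝ) * ‖hA.yosida c x‖ ^ 2 := mul_nonneg c.2.le (sq_nonneg _)
  nth_rewrite 1 [hx]
  rw [inner_sub_left, inner_smul_left, Complex.sub_re, Complex.conj_ofReal, Complex.re_ofReal_mul,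
    re_inner_self]
  linarith

/- Kato's estimate: `x - y` differs from the difference of the resolvents, on which `A` is
dissipative, by `c A_c x - d A_d y`. -/
lemma re_inner_yosida_sub_le (hA : IsMaximalDissipative A) (c d : Ioi (0 : ℝ)) {x y : E} {M : ℝ}
    (hx : ‖hA.yosida c x‖ ≤ M) (hy : ‖hA.yosida d y‖ ≤ M) :
    (inner ℂ (x - y) (hA.yosida c x - hA.yosida d y)).re ≤ 2 * (c + d) * M ^ 2 := by
  obtain ⟨c, hc : 0 < c⟩ := c
  obtain ⟨d, hd : 0 < d⟩ := d
  set v := hA.yosida ⟨c, hc⟩ x - hA.yosida ⟨d, hd⟩ y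
  set r := (d : ℂ) • hA.yosida ⟨d, hd⟩ y - (c : ℂ) • hA.yosida ⟨c, hc⟩ x with hr
  have hxy : x - y = (hA.resolvent ⟨c, hc⟩ x - hA.resolvent ⟨d, hd⟩ y) + r := by
    rw [hr, hA.smul_yosida ⟨c, hc⟩, hA.smul_yosida ⟨d, hd⟩]
    abel
  have hr_le : ‖r‖ ≤ d * M + c * M := by
    refine (norm_sub_le _ _).trans ?_
    rw [norm_smul, norm_smul, Complex.norm_of_nonneg hc.le, Complex.norm_of_nonneg hd.le]
    gcongr
  have hv_le : ‖v‖ ≤ M + M := (norm_sub_le _ _).trans (add_le_add hx hy)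
  calc (inner ℂ (x - y) v).re
      = (inner ℂ (hA.resolvent ⟨c, hc⟩ x - hA.resolvent ⟨d, hd⟩ y) v).re + (inner ℂ r v).re := by
        rw [hxy, inner_add_left, Complex.add_re]
    _ ≤ 0 + ‖r‖ * ‖v‖ := add_le_add (hA.re_inner_resolvent_sub_nonpos _ _ x y)
        ((Complex.re_le_norm _).trans (norm_inner_le_norm _ _))
    _ ≤ 0 + (d * M + c * M) * (M + M) := by
        have := (norm_nonneg r).trans hr_le
        gcongr
    _ = 2 * (c + d) * M ^ 2 := by ring

variable [CompleteSpace E]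

/-- The group generated by the Yosida approximation. -/
def flow (hA : IsMaximalDissipative A) (c : Ioi (0 : ℝ)) (t : ℝ) : E →L[ℂ] E :=
  NormedSpace.exp (t • hA.yosida c)

lemma flow_zero (hA : IsMaximalDissipative A) (c : Ioi (0 : ℝ)) (x : E) :
    hA.flow c 0 x = x := by
  simp [flow]

lemma hasDerivAt_flow (hA : IsMaximalDissipative A) (c : Ioi (0 : ℝ)) (x : E) (t : ℝ) :
    HasDerivAt (fun t => hA.flow c t x) (hA.yosida c (hA.flow c t x)) t :=
  ((ContinuousLinearMap.apply ℂ E x).restrictScalars ℝ).hasFDerivAt.comp_hasDerivAt t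
    (hasDerivAt_exp_smul_const' (𝕂 := ℝ) (hA.yosida c) t)

lemma continuous_flow (hA : IsMaximalDissipative A) (c : Ioi (0 : ℝ)) (x : E) :
    Continuous fun t => hA.flow c t x :=
  continuous_iff_continuousAt.mpr fun t => (hA.hasDerivAt_flow c x t).continuousAt

lemma yosida_flow (hA : IsMaximalDissipative A) (c : Ioi (0 : ℝ)) (x : E) (t : ℝ) :
    hA.yosida c (hA.flow c t x) = hA.flow c t (hA.yosida c x) :=
  DFunLike.congr_fun ((Commute.refl (hA.yosida c)).smul_right t).exp_right.eq x

lemma yosida_integral_flow (hA : IsMaximalDissipative A) (c : Ioi (0 : ℝ)) (x : E) (t : ℝ) :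
    hA.yosida c (∫ s in (0 : ℝ)..t, hA.flow c s x) = hA.flow c t x - x := by
  rw [← ContinuousLinearMap.intervalIntegral_comp_comm _
      ((hA.continuous_flow c x).intervalIntegrable _ _),
    intervalIntegral.integral_eq_sub_of_hasDerivAt (fun s _ => hA.hasDerivAt_flow c x s),
    hA.flow_zero]
  exact ((hA.yosida c).continuous.comp (hA.continuous_flow c x)).intervalIntegrable _ _

lemma norm_flow_le (hA : IsMaximalDissipative A) (c : Ioi (0 : ℝ)) {t : ℝ} (ht : 0 ≤ t) (x : E) :
    ‖hA.flow c t x‖ ≤ ‖x‖ := by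
  have h := norm_sq_le_of_re_inner_le (fun s _ => hA.hasDerivAt_flow c x s)
    (fun s _ => hA.re_inner_yosida_nonpos c _) ht
  rw [flow_zero, mul_zero, zero_mul, add_zero] at h
  exact (sq_le_sq₀ (norm_nonneg _) (norm_nonneg _)).mp h

lemma norm_flow_sub_flow_sq_le (hA : IsMaximalDissipative A) (c d : Ioi (0 : ℝ)) {x y : E}
    (hxy : (x, y) ∈ A.graph) {t : ℝ} (ht : 0 ≤ t) :
    ‖hA.flow c t x - hA.flow d t x‖ ^ 2 ≤ 4 * (c + d) * ‖y‖ ^ 2 * t := by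
  have hbound : ∀ b : Ioi (0 : ℝ), ∀ s : ℝ, 0 ≤ s → ‖hA.yosida b (hA.flow b s x)‖ ≤ ‖y‖ := by
    intro b s hs
    rw [yosida_flow, hA.yosida_eq_resolvent b hxy]
    exact (hA.norm_flow_le b hs _).trans (hA.norm_resolvent_le b y)
  have h := norm_sq_le_of_re_inner_le
    (fun s _ => (hA.hasDerivAt_flow c x s).sub (hA.hasDerivAt_flow d x s))
    (fun s hs => hA.re_inner_yosida_sub_le c d (hbound c s hs) (hbound d s hs)) ht
  simp only [Pi.sub_apply, flow_zero, sub_self, norm_zero] at h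
  linarith

lemma uniformCauchySeqOn_flow (hA : IsMaximalDissipative A) (x : E) (T : ℝ) :
    UniformCauchySeqOn (fun c t => hA.flow c t x) atBot (Icc 0 T) := by
  refine uniformCauchySeqOn_of_dense (fun c t ht => ?_) hA.dense_domain (fun y hy u hu => ?_) x
  · refine LipschitzWith.mk_one fun x y => ?_
    rw [dist_eq_norm, ← map_sub, dist_eq_norm]
    exact hA.norm_flow_le c ht.1 _
  obtain ⟨ε, hε, hεu⟩ := Metric.mem_uniformity_dist.mp hu
  have hzero : Tendsto (fun cd : Ioi (0 : ℝ) × Ioi (0 : ℝ) =>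
      4 * ((cd.1 : ℝ) + cd.2) * ‖A ⟨y, hy⟩‖ ^ 2 * T) (atBot ×ˢ atBot) (𝓝 0) := by
    simpa using ((((tendsto_coe_Ioi_atBot.comp tendsto_fst).add
      (tendsto_coe_Ioi_atBot.comp tendsto_snd)).const_mul 4).mul_const
      (‖A ⟨y, hy⟩‖ ^ 2)).mul_const T
  filter_upwards [hzero.eventually_lt_const (sq_pos_of_pos hε)] with cd hcd t ht
  refine hεu ?_
  rw [dist_eq_norm]
  refine lt_of_pow_lt_pow_left₀ 2 hε.le (lt_of_le_of_lt ?_ hcd)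
  refine (hA.norm_flow_sub_flow_sq_le cd.1 cd.2 (A.mem_graph ⟨y, hy⟩) ht.1).trans ?_
  have hcd0 : (0 : ℝ) ≤ cd.1 + cd.2 := add_nonneg cd.1.2.le cd.2.2.le
  have htT := ht.2
  gcongr

/-- The semigroup generated by `A`, as the limit of the groups generated by the Yosida
approximations. -/
def semigroup (hA : IsMaximalDissipative A) (t : ℝ≥0) (x : E) : E :=
  limUnder atBot fun c => hA.flow c t x

lemma tendsto_flow (hA : IsMaximalDissipative A) (x : E) (t : ℝ≥0) :
    Tendsto (fun c => hA.flow c t x) atBot (𝓝 (hA.semigroup t x)) :=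
  ((hA.uniformCauchySeqOn_flow x t).cauchy_map ⟨t.coe_nonneg, le_rfl⟩).le_nhds_lim

lemma continuous_semigroup (hA : IsMaximalDissipative A) (x : E) :
    Continuous fun t => hA.semigroup t x := by
  have hloc : TendstoLocallyUniformly (fun (c : Ioi (0 : ℝ)) (t : ℝ≥0) => hA.flow c t x)
      (fun t => hA.semigroup t x) atBot := by
    intro u hu t
    have hcauchy : UniformCauchySeqOn (fun (c : Ioi (0 : ℝ)) (t : ℝ≥0) => hA.flow c t x) atBot
        (Iic (t + 1)) :=
      ((hA.uniformCauchySeqOn_flow x (t + 1)).comp NNReal.toReal).mono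
        fun s hs => ⟨s.coe_nonneg, by exact_mod_cast hs⟩
    exact ⟨Iic (t + 1), Iic_mem_nhds (by simp),
      hcauchy.tendstoUniformlyOn_of_tendsto (fun s _ => hA.tendsto_flow x s) u hu⟩
  exact hloc.continuous (Frequently.of_forall fun c =>
    (hA.continuous_flow c x).comp NNReal.continuous_coe)

/-- The mild solution `t ↦ exp (t A) x` starting at `x`. -/
def orbit (hA : IsMaximalDissipative A) (x : E) : C(ℝ≥0, E) :=
  ⟨fun t => hA.semigroup t x, hA.continuous_semigroup x⟩

lemma tendsto_integral_flow (hA : IsMaximalDissipative A) (x : E) (t : ℝ≥0) :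
    Tendsto (fun c => ∫ s in (0 : ℝ)..t, hA.flow c s x) atBot
      (𝓝 (∫ s in (0 : ℝ)..t, hA.orbit x s.toNNReal)) := by
  refine intervalIntegral.tendsto_integral_filter_of_dominated_convergence (fun _ => ‖x‖)
    (Eventually.of_forall fun c => (hA.continuous_flow c x).aestronglyMeasurable)
    (Eventually.of_forall fun c => Eventually.of_forall fun s hs => ?_)
    intervalIntegrable_const (Eventually.of_forall fun s hs => ?_)
  all_goals rw [uIoc_of_le t.coe_nonneg] at hs
  · exact hA.norm_flow_le c hs.1.le x
  · have h := hA.tendsto_flow x s.toNNReal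
    rwa [Real.coe_toNNReal s hs.1.le] at h

lemma tendsto_resolvent_integral_flow (hA : IsMaximalDissipative A) (x : E) (t : ℝ≥0) :
    Tendsto (fun c => hA.resolvent c (∫ s in (0 : ℝ)..t, hA.flow c s x)) atBot
      (𝓝 (∫ s in (0 : ℝ)..t, hA.orbit x s.toNNReal)) := by
  have hsmall : Tendsto (fun c : Ioi (0 : ℝ) => ((c : ℝ) : ℂ) • (hA.flow c t x - x)) atBot
      (𝓝 0) := by
    simpa using ((Complex.continuous_ofReal.tendsto 0).comp tendsto_coe_Ioi_atBot).smul
      ((hA.tendsto_flow x t).sub_const x)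
  simpa only [← yosida_integral_flow, smul_yosida, add_sub_cancel, add_zero]
    using (hA.tendsto_integral_flow x t).add hsmall

theorem isMildSolution_orbit (hA : IsMaximalDissipative A) (x : E) :
    IsMildSolution A x (hA.orbit x) := by
  refine isMildSolution_iff_mem_graph.mpr fun t => ?_
  refine hA.mem_graph_of_tendsto (fun c => hA.resolvent_yosida_mem_graph c _)
    (hA.tendsto_resolvent_integral_flow x t) ?_
  simp only [yosida_integral_flow]
  exact (hA.tendsto_flow x t).sub_const x

theorem isMildSolution_unique (hA : IsMaximalDissipative A) {x : E} {U V : C(ℝ≥0, E)}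
    (hU : IsMildSolution A x U) (hV : IsMildSolution A x V) : U = V := by
  rw [isMildSolution_iff_mem_graph] at hU hV
  let W : ℝ → E := fun t => (∫ s in (0 : ℝ)..t, U s.toNNReal) - ∫ s in (0 : ℝ)..t, V s.toNNReal
  have hgraph : ∀ t : ℝ≥0, (W t, U t - V t) ∈ A.graph := fun t => by
    simpa only [Prod.mk_sub_mk, sub_sub_sub_cancel_right] using sub_mem (hU t) (hV t)
  have hderiv : ∀ t ∈ Ici (0 : ℝ), HasDerivAt W (U t.toNNReal - V t.toNNReal) t := fun t _ =>
    (hasDerivAt_integral_toNNReal U t).sub (hasDerivAt_integral_toNNReal V t)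
  have hzero : ∀ t : ℝ≥0, W t = 0 := fun t => by
    have hle := norm_sq_le_of_re_inner_le hderiv (K := 0) (fun s hs => by
      simpa only [Real.coe_toNNReal s hs] using
        hA.re_inner_nonpos_of_mem_graph (hgraph s.toNNReal)) t.coe_nonneg
    have hW0 : W 0 = 0 := by simp [W]
    rw [hW0, norm_zero, mul_zero, zero_mul, add_zero, zero_pow two_ne_zero] at hle
    exact norm_eq_zero.mp (pow_eq_zero_iff two_ne_zero |>.mp (hle.antisymm (sq_nonneg _)))
  ext t
  exact sub_eq_zero.mp (LinearPMap.graph_fst_eq_zero_snd A (hgraph t) (hzero t))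

lemma isMildSolution_primitive (hA : IsMaximalDissipative A) {x y : E} (hxy : (x, y) ∈ A.graph)
    {W : C(ℝ≥0, E)} (hW : IsMildSolution A y W) : IsMildSolution A x (primitive W x) := by
  refine isMildSolution_iff_mem_graph.mpr fun t => ?_
  have h := hA.integral_mem_graph (continuous_comp_toNNReal (primitive W x))
    (continuous_comp_toNNReal W) t.coe_nonneg
    fun s _ => primitive_mem_graph hxy hW s.toNNReal
  simpa only [primitive, ContinuousMap.coe_mk, add_sub_cancel_left] using h

theorem existsUnique_isMildSolution (hA : IsMaximalDissipative A) (x : E) :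
    ∃! U : C(ℝ≥0, E), IsMildSolution A x U :=
  ⟨hA.orbit x, hA.isMildSolution_orbit x,
    fun _ hV => hA.isMildSolution_unique hV (hA.isMildSolution_orbit x)⟩

theorem isC1_and_isContInDomain_and_isStrongSolution (hA : IsMaximalDissipative A)
    {x : E} (hx : x ∈ A.domain) {U : C(ℝ≥0, E)} (hU : IsMildSolution A x U) :
    IsC1 U ∧ IsContInDomain A U ∧ IsStrongSolution A x U := by
  have hxy := A.mem_graph ⟨x, hx⟩
  let W := hA.orbit (A ⟨x, hx⟩)
  have hW : IsMildSolution A _ W := hA.isMildSolution_orbit _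
  obtain rfl : U = primitive W x :=
    hA.isMildSolution_unique hU (hA.isMildSolution_primitive hxy hW)
  have hdom : ∀ t, primitive W x t ∈ A.domain := fun t =>
    LinearPMap.mem_domain_of_mem_graph (primitive_mem_graph hxy hW t)
  have hAU : ∀ t, A ⟨primitive W x t, hdom t⟩ = W t := fun t =>
    ((LinearPMap.image_iff (hdom t)).mpr (primitive_mem_graph hxy hW t)).symm
  refine ⟨isC1_primitive W x, ⟨hdom, ?_⟩, by simp [primitive], fun t => ⟨hdom t, ?_⟩⟩
  · simpa only [hAU] using (primitive W x).continuous.prodMk W.continuous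
  · simpa only [hAU, Real.toNNReal_coe] using hasDerivWithinAt_primitive W x t.coe_nonneg

end IsMaximalDissipative

end Dissipative

section SkewAdjoint

variable {𝕜 E : Type*} [RCLike 𝕜] [NormedAddCommGroup E] [InnerProductSpace 𝕜 E]

/-- The linear relation `T` is minus the adjoint of the linear relation `S`. Linear relations,
that is, subspaces of `E × E`, generalize graphs of operators. -/
def IsSkewAdjoint (S T : Submodule 𝕜 (E × E)) : Prop :=
  ∀ z, z ∈ T ↔ ∀ z' ∈ S, inner 𝕜 z'.2 z.1 + inner 𝕜 z'.1 z.2 = 0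

/-- The operator `(x, y) ↦ M x + y` on a linear relation, whose range is that of the sum of `M`
and the relation. -/
def addRel (S : Submodule 𝕜 (E × E)) (M : E →L[𝕜] E) : S →L[𝕜] E :=
  M.coprod (ContinuousLinearMap.id 𝕜 E) ∘L S.subtypeL

lemma addRel_apply (S : Submodule 𝕜 (E × E)) (M : E →L[𝕜] E) (z : S) :
    addRel S M z = M (z : E × E).1 + (z : E × E).2 := rfl

/-- The linear relation on a power of `E` which relates the `i`-th component of the first vector
to the `σ i`-th component of the second one through the relation `S i`. -/
def piRel {ι : Type*} (σ : ι → ι) (S : ι → Submodule 𝕜 (E × E)) :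
    Submodule 𝕜 (PiLp 2 (fun _ : ι => E) × PiLp 2 fun _ : ι => E) where
  carrier := {z | ∀ i, (z.1 i, z.2 (σ i)) ∈ S i}
  zero_mem' i := zero_mem (S i)
  add_mem' h h' i := add_mem (h i) (h' i)
  smul_mem' c _ h i := (S i).smul_mem c (h i)

lemma inner_piLp_single_left {ι : Type*} [Fintype ι] [DecidableEq ι] (i : ι) (a : E)
    (x : PiLp 2 fun _ : ι => E) : inner 𝕜 (PiLp.single 2 i a) x = inner 𝕜 a (x i) := by
  rw [PiLp.inner_apply, Finset.sum_eq_single i (fun j _ hj => ?_) (by simp), PiLp.single_eq_same]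
  rw [PiLp.single_eq_of_ne _ hj, inner_zero_left]

namespace IsSkewAdjoint

variable {S T : Submodule 𝕜 (E × E)}

lemma inner_add_inner (h : IsSkewAdjoint S T) {x x' y y' : E} (hx : (x, x') ∈ S)
    (hy : (y, y') ∈ T) : inner 𝕜 x' y + inner 𝕜 x y' = 0 :=
  (h _).mp hy _ hx

lemma isClosed (h : IsSkewAdjoint S T) : IsClosed (T : Set (E × E)) := by
  have hT : (T : Set (E × E)) = ⋂ z' ∈ S, {z | inner 𝕜 z'.2 z.1 + inner 𝕜 z'.1 z.2 = 0} := by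
    ext z
    simpa using h z
  rw [hT]
  exact isClosed_biInter fun z' _ => isClosed_eq (by fun_prop) continuous_const

lemma topologicalClosure_left (h : IsSkewAdjoint S T) : IsSkewAdjoint S.topologicalClosure T := by
  refine fun z => ⟨fun hz z' hz' => ?_, fun hz =>
    (h z).mpr fun z' hz' => hz z' (S.le_topologicalClosure hz')⟩
  have hcl : IsClosed {z' : E × E | inner 𝕜 z'.2 z.1 + inner 𝕜 z'.1 z.2 = 0} :=
    isClosed_eq (by fun_prop) continuous_const
  exact closure_minimal (fun z' hz' => (h z).mp hz z' hz') hcl hz'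

/- Up to exchanging the components, `T` is the orthogonal complement of `S` in the Hilbert sum
`E ⊕ E`. -/
lemma symm_topologicalClosure [CompleteSpace E] (h : IsSkewAdjoint S T) :
    IsSkewAdjoint T S.topologicalClosure := by
  refine fun z => ⟨fun hz z' hz' => ?_, fun hz => ?_⟩
  · have := congrArg (starRingEnd 𝕜) (h.topologicalClosure_left.inner_add_inner hz hz')
    simpa only [map_add, inner_conj_symm, map_zero, add_comm] using this
  · let e := WithLp.prodContinuousLinearEquiv 2 𝕜 E E
    let K : Submodule 𝕜 (WithLp 2 (E × E)) := S.topologicalClosure.comap e.toLinearMap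
    have hK : IsClosed (K : Set (WithLp 2 (E × E))) :=
      S.isClosed_topologicalClosure.preimage e.continuous
    have : CompleteSpace K := hK.completeSpace_coe
    change e.symm z ∈ K
    rw [← K.orthogonal_orthogonal, Submodule.mem_orthogonal]
    intro v hv
    have hv' : (v.snd, v.fst) ∈ T := (h _).mpr fun z' hz' => by
      have := (Submodule.mem_orthogonal _ _).mp hv (e.symm z') (S.le_topologicalClosure hz')
      rwa [WithLp.prod_inner_apply, add_comm] at this
    have := hz _ hv'
    rwa [WithLp.prod_inner_apply]

lemma re_inner_eq_zero (h : IsSkewAdjoint S S) {x y : E} (hxy : (x, y) ∈ S) :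
    RCLike.re (inner 𝕜 x y) = 0 := by
  have := congrArg RCLike.re (h.inner_add_inner hxy hxy)
  rw [map_add, map_zero, inner_re_symm] at this
  linarith

section Coercive

variable {M : E →L[𝕜] E} {k : ℝ}

lemma norm_le_of_coercive (h : IsSkewAdjoint S S) (hk : 0 < k)
    (hM : ∀ x, k * ‖x‖ ^ 2 ≤ RCLike.re (inner 𝕜 x (M x))) {x y : E} (hxy : (x, y) ∈ S) :
    ‖x‖ ≤ k⁻¹ * ‖M x + y‖ := by
  have hre : k * ‖x‖ ^ 2 ≤ ‖x‖ * ‖M x + y‖ := calc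
    k * ‖x‖ ^ 2 ≤ RCLike.re (inner 𝕜 x (M x + y)) := by
      rw [inner_add_right, map_add, h.re_inner_eq_zero hxy, add_zero]
      exact hM x
    _ ≤ ‖x‖ * ‖M x + y‖ := (RCLike.re_le_norm _).trans (norm_inner_le_norm _ _)
  rw [← div_eq_inv_mul, le_div_iff₀' hk]
  rcases (norm_nonneg x).eq_or_lt with h0 | h0
  · rw [← h0, mul_zero]
    exact norm_nonneg _
  · exact le_of_mul_le_mul_left (by linarith) h0

variable [CompleteSpace E]

lemma isClosed_range_addRel (h : IsSkewAdjoint S S) (hk : 0 < k)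
    (hM : ∀ x, k * ‖x‖ ^ 2 ≤ RCLike.re (inner 𝕜 x (M x))) :
    IsClosed ((addRel S M).range : Set E) := by
  have : CompleteSpace S := h.isClosed.completeSpace_coe
  have hanti : ∀ z : S, ‖z‖ ≤ (k⁻¹ + (1 + ‖M‖ * k⁻¹)) * ‖addRel S M z‖ := by
    rintro ⟨⟨x, y⟩, hxy⟩
    set f := addRel S M ⟨(x, y), hxy⟩ with hf
    have hx : ‖x‖ ≤ k⁻¹ * ‖f‖ := h.norm_le_of_coercive hk hM hxy
    have hy : ‖y‖ ≤ (1 + ‖M‖ * k⁻¹) * ‖f‖ := calc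
      ‖y‖ = ‖f - M x‖ := by rw [hf, addRel_apply, add_sub_cancel_left]
      _ ≤ ‖f‖ + ‖M‖ * ‖x‖ := (norm_sub_le _ _).trans (add_le_add_right (M.le_opNorm x) _)
      _ ≤ ‖f‖ + ‖M‖ * (k⁻¹ * ‖f‖) := by gcongr
      _ = (1 + ‖M‖ * k⁻¹) * ‖f‖ := by ring
    rw [add_mul]
    exact max_le (hx.trans (le_add_of_nonneg_right (by positivity)))
      (hy.trans (le_add_of_nonneg_left (by positivity)))
  exact ((addRel S M).antilipschitz_of_bound (K := ⟨_, by positivity⟩) hanti).isClosed_range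
    (addRel S M).uniformContinuous

lemma orthogonal_range_addRel (h : IsSkewAdjoint S S) (hk : 0 < k)
    (hM : ∀ x, k * ‖x‖ ^ 2 ≤ RCLike.re (inner 𝕜 x (M x))) : (addRel S M).rangeᗮ = ⊥ := by
  refine (Submodule.eq_bot_iff _).mpr fun v hv => ?_
  have hvS : (v, M.adjoint v) ∈ S := (h _).mpr fun z hz => by
    have : inner 𝕜 (M z.1 + z.2) v = 0 :=
      (Submodule.mem_orthogonal _ _).mp hv _ ⟨⟨z, hz⟩, rfl⟩
    rwa [inner_add_left, add_comm, ← ContinuousLinearMap.adjoint_inner_right] at this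
  have hre := h.re_inner_eq_zero hvS
  rw [ContinuousLinearMap.adjoint_inner_right, inner_re_symm] at hre
  have hv0 : ‖v‖ ^ 2 ≤ 0 := nonpos_of_mul_nonpos_right ((hM v).trans hre.le) hk
  exact norm_eq_zero.mp (pow_eq_zero_iff two_ne_zero |>.mp (hv0.antisymm (sq_nonneg _)))

theorem exists_add_eq_of_coercive (h : IsSkewAdjoint S S) (hk : 0 < k)
    (hM : ∀ x, k * ‖x‖ ^ 2 ≤ RCLike.re (inner 𝕜 x (M x))) (f : E) :
    ∃ x y, (x, y) ∈ S ∧ M x + y = f := by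
  have htop := Submodule.topologicalClosure_eq_top_iff.mpr (h.orthogonal_range_addRel hk hM)
  rw [(h.isClosed_range_addRel hk hM).submodule_topologicalClosure_eq] at htop
  obtain ⟨z, hz⟩ := LinearMap.range_eq_top.mp htop f
  exact ⟨_, _, z.2, hz⟩

end Coercive

section Pi

variable {ι : Type*} {σ : ι → ι} {S : ι → Submodule 𝕜 (E × E)} [Fintype ι]

protected theorem piRel (hσ : σ.Involutive) (h : ∀ i, IsSkewAdjoint (S i) (S (σ i))) :
    IsSkewAdjoint (piRel σ S) (piRel σ S) := by
  classical
  have hsum : ∀ z z' : PiLp 2 (fun _ : ι => E) × PiLp 2 fun _ : ι => E,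
      inner 𝕜 z'.2 z.1 + inner 𝕜 z'.1 z.2 =
        ∑ i, (inner 𝕜 (z'.2 (σ i)) (z.1 (σ i)) + inner 𝕜 (z'.1 i) (z.2 i)) := fun z z' => by
    rw [PiLp.inner_apply, PiLp.inner_apply, Finset.sum_add_distrib,
      ← Equiv.sum_comp hσ.toPerm fun i => inner 𝕜 (z'.2 i) (z.1 i)]
    rfl
  refine fun z => ⟨fun hz z' hz' => ?_, fun hz i => ?_⟩
  · rw [hsum]
    refine Finset.sum_eq_zero fun i _ => (h i).inner_add_inner (hz' i) ?_
    simpa only [hσ i] using hz (σ i)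
  · have hi := h (σ i)
    rw [hσ i] at hi
    refine (hi _).mpr fun y hy => ?_
    have hy' : (PiLp.single 2 (σ i) y.1, PiLp.single 2 i y.2) ∈ piRel σ S := fun j => by
      obtain rfl | hj := eq_or_ne j (σ i)
      · simpa [hσ i] using hy
      · have : σ j ≠ i := fun hji => hj (by rw [← hji, hσ j])
        simp [hj, this, Prod.mk_zero_zero]
    simpa only [inner_piLp_single_left] using hz _ hy'

end Pi

end IsSkewAdjoint

end SkewAdjoint

section Stationary

variable {𝕜 E : Type*} [RCLike 𝕜] [NormedAddCommGroup E] [InnerProductSpace 𝕜 E]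

lemma exists_le_norm_sub_smul_sq {k ν : ℝ} (hk : 0 < k) (hν : 0 < ν) (η : ℝ) :
    ∃ k' : ℝ, 0 < k' ∧ ∀ x y : E,
      k' * (‖x‖ ^ 2 + ‖y‖ ^ 2) ≤ k * ‖x - (η : 𝕜) • y‖ ^ 2 + ν * ‖y‖ ^ 2 := by
  refine ⟨min (k / 2) (ν / (1 + 2 * η ^ 2)), by positivity, fun x y => ?_⟩
  set k' := min (k / 2) (ν / (1 + 2 * η ^ 2))
  have hk' : 2 * k' ≤ k := by
    linarith [min_le_left (k / 2) (ν / (1 + 2 * η ^ 2))]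
  have hν' : k' * (1 + 2 * η ^ 2) ≤ ν :=
    (le_div_iff₀ (by positivity)).mp (min_le_right (k / 2) (ν / (1 + 2 * η ^ 2)))
  have hx : ‖x‖ ^ 2 ≤ 2 * (‖x - (η : 𝕜) • y‖ ^ 2 + (|η| * ‖y‖) ^ 2) := by
    refine le_trans ?_ (add_sq_le (a := ‖x - (η : 𝕜) • y‖))
    gcongr
    calc ‖x‖ = ‖x - (η : 𝕜) • y + (η : 𝕜) • y‖ := by rw [sub_add_cancel]
      _ ≤ ‖x - (η : 𝕜) • y‖ + ‖(η : 𝕜) • y‖ := norm_add_le _ _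
      _ = ‖x - (η : 𝕜) • y‖ + |η| * ‖y‖ := by rw [norm_smul, RCLike.norm_ofReal]
  rw [mul_pow, sq_abs] at hx
  have : 0 ≤ k' := by positivity
  calc k' * (‖x‖ ^ 2 + ‖y‖ ^ 2)
      ≤ k' * (2 * (‖x - (η : 𝕜) • y‖ ^ 2 + η ^ 2 * ‖y‖ ^ 2) + ‖y‖ ^ 2) := by gcongr
    _ = 2 * k' * ‖x - (η : 𝕜) • y‖ ^ 2 + k' * (1 + 2 * η ^ 2) * ‖y‖ ^ 2 := by ring
    _ ≤ k * ‖x - (η : 𝕜) • y‖ ^ 2 + ν * ‖y‖ ^ 2 := by gcongr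

/-- The zeroth-order part of the stationary problem for the unknowns `(w, σ, θ, Q)`, see
`exists_stationary_solution`. -/
def stationaryOp (m a : E →L[𝕜] E) (η ν γ : ℝ) :
    PiLp 2 (fun _ : Fin 4 => E) →L[𝕜] PiLp 2 fun _ : Fin 4 => E :=
  let x (i : Fin 4) := PiLp.proj (𝕜 := 𝕜) 2 (fun _ : Fin 4 => E) i
  let s := a ∘L (x 1 - (η : 𝕜) • x 2)
  (PiLp.continuousLinearEquiv 2 𝕜 fun _ : Fin 4 => E).symm.toContinuousLinearMap ∘L
    ContinuousLinearMap.pi ![m ∘L x 0, s, (ν : 𝕜) • x 2 - (η : 𝕜) • s, (γ : 𝕜) • x 3]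

variable {m a : E →L[𝕜] E} {η ν γ : ℝ}

lemma re_inner_stationaryOp (x : PiLp 2 fun _ : Fin 4 => E) :
    RCLike.re (inner 𝕜 x (stationaryOp m a η ν γ x)) = RCLike.re (inner 𝕜 (x 0) (m (x 0)))
      + RCLike.re (inner 𝕜 (x 1 - (η : 𝕜) • x 2) (a (x 1 - (η : 𝕜) • x 2)))
      + ν * ‖x 2‖ ^ 2 + γ * ‖x 3‖ ^ 2 := by
  have h : inner 𝕜 x (stationaryOp m a η ν γ x) = inner 𝕜 (x 0) (m (x 0))
      + inner 𝕜 (x 1) (a (x 1 - (η : 𝕜) • x 2))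
      + inner 𝕜 (x 2) ((ν : 𝕜) • x 2 - (η : 𝕜) • a (x 1 - (η : 𝕜) • x 2))
      + inner 𝕜 (x 3) ((γ : 𝕜) • x 3) := by
    rw [PiLp.inner_apply, Fin.sum_univ_four]
    rfl
  simp only [h, inner_sub_left, inner_sub_right, inner_smul_left, inner_smul_right,
    RCLike.conj_ofReal, map_add, map_sub, RCLike.re_ofReal_mul, inner_self_eq_norm_sq]
  ring

lemma exists_stationaryOp_coercive {km ka : ℝ} (hkm : 0 < km) (hka : 0 < ka) (hν : 0 < ν)
    (hγ : 0 < γ) (hm : ∀ x, km * ‖x‖ ^ 2 ≤ RCLike.re (inner 𝕜 x (m x)))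
    (ha : ∀ x, ka * ‖x‖ ^ 2 ≤ RCLike.re (inner 𝕜 x (a x))) :
    ∃ k : ℝ, 0 < k ∧ ∀ x : PiLp 2 fun _ : Fin 4 => E,
      k * ‖x‖ ^ 2 ≤ RCLike.re (inner 𝕜 x (stationaryOp m a η ν γ x)) := by
  obtain ⟨k', hk', h⟩ := exists_le_norm_sub_smul_sq (𝕜 := 𝕜) (E := E) hka hν η
  refine ⟨min km (min k' γ), by positivity, fun x => ?_⟩
  calc min km (min k' γ) * ‖x‖ ^ 2
      = min km (min k' γ) * ‖x 0‖ ^ 2 + min km (min k' γ) * (‖x 1‖ ^ 2 + ‖x 2‖ ^ 2)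
        + min km (min k' γ) * ‖x 3‖ ^ 2 := by
        rw [PiLp.norm_sq_eq_of_L2, Fin.sum_univ_four]
        ring
    _ ≤ km * ‖x 0‖ ^ 2 + k' * (‖x 1‖ ^ 2 + ‖x 2‖ ^ 2) + γ * ‖x 3‖ ^ 2 := by
        gcongr
        · exact min_le_left _ _
        · exact (min_le_right _ _).trans (min_le_left _ _)
        · exact (min_le_right _ _).trans (min_le_right _ _)
    _ ≤ RCLike.re (inner 𝕜 x (stationaryOp m a η ν γ x)) := by
        rw [re_inner_stationaryOp]
        linarith [hm (x 0), ha (x 1 - (η : 𝕜) • x 2), h (x 1) (x 2)]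

theorem exists_stationary_solution [CompleteSpace E] {G₀ G Gθ Gq : Submodule 𝕜 (E × E)}
    (hG₀ : IsSkewAdjoint G₀ G) (hG : IsSkewAdjoint G G₀) (hGθ : IsSkewAdjoint Gθ Gq)
    (hGq : IsSkewAdjoint Gq Gθ) {km ka : ℝ} (hkm : 0 < km) (hka : 0 < ka) (hν : 0 < ν)
    (hγ : 0 < γ) (hm : ∀ x, km * ‖x‖ ^ 2 ≤ RCLike.re (inner 𝕜 x (m x)))
    (ha : ∀ x, ka * ‖x‖ ^ 2 ≤ RCLike.re (inner 𝕜 x (a x))) (f₀ f₁ f₂ f₃ : E) :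
    ∃ w w' σ σ' θ θ' Q Q' : E,
      (w, w') ∈ G₀ ∧ (σ, σ') ∈ G ∧ (θ, θ') ∈ Gθ ∧ (Q, Q') ∈ Gq ∧
      m w + σ' = f₀ ∧ a (σ - (η : 𝕜) • θ) + w' = f₁ ∧
      (ν : 𝕜) • θ - (η : 𝕜) • a (σ - (η : 𝕜) • θ) + Q' = f₂ ∧ (γ : 𝕜) • Q + θ' = f₃ := by
  have hR : IsSkewAdjoint (piRel ![1, 0, 3, 2] ![G₀, G, Gθ, Gq])
      (piRel ![1, 0, 3, 2] ![G₀, G, Gθ, Gq]) :=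
    .piRel (fun i => by fin_cases i <;> rfl) fun i => by fin_cases i <;> assumption
  obtain ⟨k, hk, hM⟩ := exists_stationaryOp_coercive (η := η) hkm hka hν hγ hm ha
  obtain ⟨x, y, hxy, h⟩ := hR.exists_add_eq_of_coercive hk hM (WithLp.toLp 2 ![f₀, f₁, f₂, f₃])
  have hi (i : Fin 4) := congrArg (fun f : PiLp 2 (fun _ : Fin 4 => E) => f i) h
  exact ⟨x 0, y 1, x 1, y 0, x 2, y 3, x 3, y 2, hxy 0, hxy 1, hxy 2, hxy 3,
    hi 0, hi 1, hi 2, hi 3⟩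

end Stationary

section WeakDerivatives

variable {L : ℝ}

lemma IsTest.star {φ : ℝ → ℂ} (h : IsTest L φ) : IsTest L (star φ) where
  smooth := Complex.conjCLE.contDiff.comp h.smooth
  compact := h.compact.comp_left (g := fun z : ℂ => conj z) (by simp)
  supp := (closure_mono fun x hx => by simpa using hx).trans h.supp

lemma deriv_star_eq (φ : ℝ → ℂ) : deriv (star φ) = star (deriv φ) :=
  funext fun _ => deriv.star

lemma inner_eq_integral {z : L2 L} {φ : ℝ → ℂ} (h : z =ᵐ[vol L] star φ) (f : L2 L) :
    inner ℂ z f = ∫ x, f x * φ x ∂(vol L) := by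
  rw [L2.inner_def]
  refine integral_congr_ae ?_
  filter_upwards [h] with x hx
  simp [hx, RCLike.inner_apply]

theorem isSkewAdjoint_testGraph_weakGraph (L : ℝ) :
    IsSkewAdjoint (testGraph L) (weakGraph L) := by
  refine fun z => ⟨?_, fun h φ hφ => ?_⟩
  · rintro hz z' ⟨φ, hφ, h₁, h₂⟩
    rw [inner_eq_integral (φ := deriv (star φ)) (by rwa [deriv_star_eq, star_star]),
      inner_eq_integral (φ := star φ) (by rwa [star_star]),
      hz _ hφ.star, neg_add_cancel]
  · have := h (hφ.star.memLp.toLp, hφ.star.deriv.memLp.toLp)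
      ⟨star φ, hφ.star, hφ.star.memLp.coeFn_toLp, hφ.star.deriv.memLp.coeFn_toLp⟩
    rw [inner_eq_integral hφ.star.memLp.coeFn_toLp, inner_eq_integral (φ := deriv φ)
      (hφ.star.deriv.memLp.coeFn_toLp.trans (by rw [deriv_star_eq]))] at this
    exact eq_neg_of_add_eq_zero_left this

lemma isSkewAdjoint_closure_weakGraph (L : ℝ) :
    IsSkewAdjoint (testGraph L).topologicalClosure (weakGraph L) :=
  (isSkewAdjoint_testGraph_weakGraph L).topologicalClosure_left

lemma isSkewAdjoint_weakGraph_closure (L : ℝ) :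
    IsSkewAdjoint (weakGraph L) (testGraph L).topologicalClosure :=
  (isSkewAdjoint_testGraph_weakGraph L).symm_topologicalClosure

lemma H1_eq_map : H1 L = (weakGraph L).map (LinearMap.fst ℂ (L2 L) (L2 L)) := by
  refine Submodule.ext fun f => mem_H1_iff.trans ⟨fun ⟨g, hg⟩ => ⟨(f, g), hg, rfl⟩, ?_⟩
  rintro ⟨⟨_, g⟩, hg, rfl⟩
  exact ⟨g, hg⟩

lemma mk_dx_mem_of_le_weakGraph {T : Submodule ℂ (L2 L × L2 L)} (hT : T ≤ weakGraph L)
    {f : H1 L} (hf : (f : L2 L) ∈ T.map (LinearMap.fst ℂ (L2 L) (L2 L))) :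
    ((f : L2 L), dx L f) ∈ T := by
  obtain ⟨⟨f', g⟩, hfg, rfl : f' = f⟩ := hf
  rwa [dx_eq (hT hfg) f.2]

namespace Boundary

variable (L) in
/-- The graph of the derivative on the space prescribed for `θ`. -/
def θGraph : Boundary → Submodule ℂ (L2 L × L2 L)
  | temperature => (testGraph L).topologicalClosure
  | flux => weakGraph L

variable (L) in
/-- The graph of the derivative on the space prescribed for `q`. -/
def qGraph : Boundary → Submodule ℂ (L2 L × L2 L)
  | temperature => weakGraph L
  | flux => (testGraph L).topologicalClosure

variable (bc : Boundary)

lemma θGraph_le : bc.θGraph L ≤ weakGraph L := by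
  cases bc
  · exact closure_testGraph_le
  · exact le_rfl

lemma qGraph_le : bc.qGraph L ≤ weakGraph L := by
  cases bc
  · exact le_rfl
  · exact closure_testGraph_le

lemma θSpace_eq_map : bc.θSpace L = (bc.θGraph L).map (LinearMap.fst ℂ (L2 L) (L2 L)) := by
  cases bc
  · rfl
  · exact H1_eq_map

lemma qSpace_eq_map : bc.qSpace L = (bc.qGraph L).map (LinearMap.fst ℂ (L2 L) (L2 L)) := by
  cases bc
  · exact H1_eq_map
  · rfl

lemma isSkewAdjoint_θGraph_qGraph : IsSkewAdjoint (bc.θGraph L) (bc.qGraph L) := by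
  cases bc
  · exact isSkewAdjoint_closure_weakGraph L
  · exact isSkewAdjoint_weakGraph_closure L

lemma isSkewAdjoint_qGraph_θGraph : IsSkewAdjoint (bc.qGraph L) (bc.θGraph L) := by
  cases bc
  · exact isSkewAdjoint_weakGraph_closure L
  · exact isSkewAdjoint_closure_weakGraph L

end Boundary

end WeakDerivatives

section Multiplication

variable {L : ℝ} {a b : ℝ → ℝ}

lemma coeFn_mulL2 (ha : ContinuousOn a (Icc 0 L)) (f : L2 L) :
    mulL2 a ha f =ᵐ[vol L] fun x => (a x : ℂ) * f x :=
  (memLp_mul ha f).coeFn_toLp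

/-- Multiplication by the continuous function `a` as a bounded operator on `L²(0, L)`. -/
def mulCLM (a : ℝ → ℝ) (ha : ContinuousOn a (Icc 0 L)) : L2 L →L[ℂ] L2 L :=
  LinearMap.mkContinuousOfExistsBound (mulL2 a ha) <| by
    obtain ⟨C, hC⟩ := isCompact_Icc.exists_bound_of_continuousOn ha
    refine ⟨C, fun f => Lp.norm_le_mul_norm_of_ae_le_mul ?_⟩
    filter_upwards [coeFn_mulL2 ha f, ae_restrict_mem measurableSet_Ioo] with x hx hxm
    rw [hx, norm_mul, Complex.norm_real]
    exact mul_le_mul_of_nonneg_right (hC x (Ioo_subset_Icc_self hxm)) (norm_nonneg _)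

lemma mulL2_mulL2_of_mul_eq_one (ha : ContinuousOn a (Icc 0 L)) (hb : ContinuousOn b (Icc 0 L))
    (hab : ∀ x ∈ Icc 0 L, a x * b x = 1) (f : L2 L) : mulL2 a ha (mulL2 b hb f) = f := by
  refine Lp.ext ?_
  filter_upwards [coeFn_mulL2 ha (mulL2 b hb f), coeFn_mulL2 hb f,
    ae_restrict_mem measurableSet_Ioo] with x hx hx' hxm
  rw [hx, hx', ← mul_assoc, ← Complex.ofReal_mul, hab x (Ioo_subset_Icc_self hxm),
    Complex.ofReal_one, one_mul]

lemma mulL2_one (f : L2 L) : mulL2 (fun _ => 1) continuousOn_const f = f := by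
  refine Lp.ext ((coeFn_mulL2 continuousOn_const f).trans ?_)
  simp

lemma mulL2_linear_combination (ha : ContinuousOn a (Icc 0 L)) (hb : ContinuousOn b (Icc 0 L))
    (s t : ℝ) (hab : ContinuousOn (fun x => s * a x + t * b x) (Icc 0 L)) (f : L2 L) :
    mulL2 (fun x => s * a x + t * b x) hab f =
      (s : ℂ) • mulL2 a ha f + (t : ℂ) • mulL2 b hb f := by
  refine Lp.ext ?_
  filter_upwards [coeFn_mulL2 hab f, coeFn_mulL2 ha f, coeFn_mulL2 hb f,
    Lp.coeFn_add ((s : ℂ) • mulL2 a ha f) ((t : ℂ) • mulL2 b hb f),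
    Lp.coeFn_smul (s : ℂ) (mulL2 a ha f), Lp.coeFn_smul (t : ℂ) (mulL2 b hb f)]
    with x h ha hb h' hs ht
  rw [h, h', Pi.add_apply, hs, ht, Pi.smul_apply, Pi.smul_apply, ha, hb, smul_eq_mul, smul_eq_mul]
  push_cast
  ring

lemma inner_mulL2_left (ha : ContinuousOn a (Icc 0 L)) (f g : L2 L) :
    inner ℂ (mulL2 a ha f) g = inner ℂ f (mulL2 a ha g) := by
  rw [← inner_conj_symm, ← wform_eq_inner, wform_conj, wform_eq_inner]

lemma exists_le_re_inner_mulL2 (hL : 0 < L) (ha : ContinuousOn a (Icc 0 L))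
    (hpos : ∀ x ∈ Icc 0 L, 0 < a x) :
    ∃ k : ℝ, 0 < k ∧ ∀ f : L2 L, k * ‖f‖ ^ 2 ≤ (inner ℂ f (mulL2 a ha f)).re := by
  obtain ⟨k, _, hk, _, h⟩ := wform_bounds hL ha hpos
  exact ⟨k, hk, fun f => by simpa only [wform_eq_inner ha] using (h f).1⟩

end Multiplication

section Operator

open PhaseSpace

variable {B : Beam} {bc : Boundary}

lemma mulL2_m_inv_m (f : L2 B.L) :
    mulL2 B.m B.m_cont (mulL2 (fun x => 1 / B.m x) (inv_m_cont B) f) = f :=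
  mulL2_mulL2_of_mul_eq_one _ _ (fun x hx => mul_one_div_cancel (B.m_pos x hx).ne') f

lemma inv_m_mulL2_m (f : L2 B.L) :
    mulL2 (fun x => 1 / B.m x) (inv_m_cont B) (mulL2 B.m B.m_cont f) = f :=
  mulL2_mulL2_of_mul_eq_one _ _ (fun x hx => one_div_mul_cancel (B.m_pos x hx).ne') f

lemma τ_smul_q_opFun (U : opDomain B bc) : (B.τ : ℂ) • q (opFun U) =
    -((B.κ : ℂ) • dx B.L (θ1 U) + (B.β : ℂ) • q (U : PhaseSpace B)) := by
  have hτ : (B.τ : ℂ) ≠ 0 := by exact_mod_cast B.τ_pos.ne'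
  rw [opFun, q_mk, smul_smul, mul_div_cancel₀ _ hτ, neg_one_smul]

variable {U V : PhaseSpace B}

lemma w_eq_and_mem_weakGraph_opFun (U : opDomain B bc) : w (U : PhaseSpace B) = u (opFun U) ∧
    (stress B (u (U : PhaseSpace B)) (u (opFun U)) - (B.η : ℂ) • θ (U : PhaseSpace B),
      mulL2 B.m B.m_cont (w (opFun U))) ∈ weakGraph B.L := by
  rw [opFun, w_mk, mulL2_m_inv_m]
  exact ⟨rfl, dx_spec (stress1 U - (B.η : ℂ) • θ1 U)⟩

lemma mem_graph_op_of_weak (hw : w U = u V)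
    (hσ : (stress B (u U) (u V) - (B.η : ℂ) • θ U, mulL2 B.m B.m_cont (w V)) ∈ weakGraph B.L)
    {θx qx : L2 B.L} (hθ : (θ U, θx) ∈ bc.θGraph B.L) (hq : (q U, qx) ∈ bc.qGraph B.L)
    (hθV : θ V = -((B.κ : ℂ) • qx) - (B.η : ℂ) • dx0 B.L (u V))
    (hqV : (B.τ : ℂ) • q V = -((B.κ : ℂ) • θx + (B.β : ℂ) • q U)) :
    (U, V) ∈ (op B bc).graph := by
  have hwmem : w U ∈ H10 B.L := hw ▸ (u V).2
  have hwu : u V = ⟨w U, hwmem⟩ := Subtype.ext hw.symm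
  rw [hwu] at hσ hθV
  have hσ' := (weakGraph B.L).add_mem hσ ((weakGraph B.L).smul_mem (B.η : ℂ) (bc.θGraph_le hθ))
  rw [Prod.smul_mk, Prod.mk_add_mk, sub_add_cancel] at hσ'
  let W : opDomain B bc := ⟨U, ⟨hwmem, mem_H1_iff.mpr ⟨_, hσ'⟩⟩,
    bc.θSpace_eq_map ▸ ⟨_, hθ, rfl⟩, bc.qSpace_eq_map ▸ ⟨_, hq, rfl⟩⟩
  have hσx : dx B.L (stress1 W - (B.η : ℂ) • θ1 W) = mulL2 B.m B.m_cont (w V) := dx_eq hσ _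
  have hθx : dx B.L (θ1 W) = θx := dx_eq (bc.θGraph_le hθ) _
  have hqx : dx B.L (q1 W) = qx := dx_eq (bc.qGraph_le hq) _
  rw [← hqx] at hθV
  rw [← hθx] at hqV
  refine LinearPMap.mem_graph_iff _ |>.mpr ⟨W, rfl, ext' hwu.symm ?_ hθV.symm ?_⟩
  · exact (congrArg _ hσx).trans (inv_m_mulL2_m _)
  · have hτ : (B.τ : ℂ) ≠ 0 := by exact_mod_cast B.τ_pos.ne'
    exact smul_right_injective _ hτ ((τ_smul_q_opFun W).trans hqV.symm)

/- The graph of `𝒜` in terms of the closed skew-adjoint relations `θGraph`, `qGraph` and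
`weakGraph`, so that integration by parts applies to it for both boundary conditions at once. -/
theorem mem_graph_op_iff : (U, V) ∈ (op B bc).graph ↔ w U = u V ∧
    (stress B (u U) (u V) - (B.η : ℂ) • θ U, mulL2 B.m B.m_cont (w V)) ∈ weakGraph B.L ∧
    ∃ θx qx, (θ U, θx) ∈ bc.θGraph B.L ∧ (q U, qx) ∈ bc.qGraph B.L ∧
      θ V = -((B.κ : ℂ) • qx) - (B.η : ℂ) • dx0 B.L (u V) ∧
      (B.τ : ℂ) • q V = -((B.κ : ℂ) • θx + (B.β : ℂ) • q U) := by
  refine ⟨fun h => ?_, fun ⟨hw, hσ, θx, qx, hθ, hq, hθV, hqV⟩ =>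
    mem_graph_op_of_weak hw hσ hθ hq hθV hqV⟩
  obtain ⟨U, rfl, rfl⟩ := LinearPMap.mem_graph_iff _ |>.mp h
  obtain ⟨hw, hσ⟩ := w_eq_and_mem_weakGraph_opFun U
  exact ⟨hw, hσ, dx B.L (θ1 U), dx B.L (q1 U),
    mk_dx_mem_of_le_weakGraph (f := θ1 U) bc.θGraph_le (bc.θSpace_eq_map ▸ U.2.2.1),
    mk_dx_mem_of_le_weakGraph (f := q1 U) bc.qGraph_le (bc.qSpace_eq_map ▸ U.2.2.2),
    rfl, τ_smul_q_opFun U⟩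

lemma inner_eq_inner_mulL2 (U V : PhaseSpace B) :
    inner ℂ U V = inner ℂ (dx0 B.L (u U)) (mulL2 B.p B.p_cont (dx0 B.L (u V)))
      + inner ℂ (w U) (mulL2 B.m B.m_cont (w V)) + inner ℂ (θ U) (θ V)
      + inner ℂ (q U) ((B.τ : ℂ) • q V) := by
  rw [PhaseSpace.inner_eq, form, wform_eq_inner B.p_cont, wform_eq_inner B.m_cont,
    wform_eq_inner continuousOn_const, wform_eq_inner continuousOn_const, mulL2_one, mulL2_one,
    inner_smul_right]

lemma inner_w_mulL2_of_mem_graph_op (h : (U, V) ∈ (op B bc).graph) :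
    inner ℂ (w U) (mulL2 B.m B.m_cont (w V)) =
      -inner ℂ (dx0 B.L (u V)) (mulL2 B.p B.p_cont (dx0 B.L (u U)))
        - 2 * inner ℂ (dx0 B.L (u V)) (mulL2 B.δ B.δ_cont (dx0 B.L (u V)))
        + B.η * inner ℂ (dx0 B.L (u V)) (θ U) := by
  obtain ⟨hw, hσ, -⟩ := mem_graph_op_iff.mp h
  have := (isSkewAdjoint_closure_weakGraph B.L).inner_add_inner (dx0_mem (u V)) hσ
  rw [← hw, stress, inner_sub_right, inner_add_right, inner_smul_right, inner_smul_right] at this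
  linear_combination this

lemma re_inner_comm_of_mulL2 {L : ℝ} {a : ℝ → ℝ} (ha : ContinuousOn a (Icc 0 L)) (f g : L2 L) :
    (inner ℂ f (mulL2 a ha g)).re = (inner ℂ g (mulL2 a ha f)).re := by
  rw [← inner_mulL2_left]
  exact inner_re_symm (𝕜 := ℂ) _ _

theorem re_inner_of_mem_graph_op (h : (U, V) ∈ (op B bc).graph) :
    (inner ℂ U V).re =
      -(2 * (inner ℂ (dx0 B.L (u V)) (mulL2 B.δ B.δ_cont (dx0 B.L (u V)))).re)
        - B.β * ‖q U‖ ^ 2 := by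
  obtain ⟨-, -, θx, qx, hθ, hq, hθV, hqV⟩ := mem_graph_op_iff.mp h
  have hp := re_inner_comm_of_mulL2 B.p_cont (dx0 B.L (u U)) (dx0 B.L (u V))
  have hθw : (inner ℂ (θ U) (dx0 B.L (u V))).re = (inner ℂ (dx0 B.L (u V)) (θ U)).re :=
    inner_re_symm (𝕜 := ℂ) _ _
  have hθq : (inner ℂ (q U) θx).re + (inner ℂ (θ U) qx).re = 0 := by
    rw [show (inner ℂ (q U) θx).re = (inner ℂ θx (q U)).re from inner_re_symm (𝕜 := ℂ) _ _]
    exact congrArg Complex.re (bc.isSkewAdjoint_θGraph_qGraph.inner_add_inner hθ hq)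
  rw [inner_eq_inner_mulL2, inner_w_mulL2_of_mem_graph_op h, hθV, hqV]
  simp only [inner_sub_right, inner_neg_right, inner_add_right, inner_smul_right, Complex.add_re,
    Complex.sub_re, Complex.neg_re, Complex.re_ofReal_mul, re_inner_self, hp, hθw]
  rw [show (2 : ℂ) = ((2 : ℝ) : ℂ) by norm_num, Complex.re_ofReal_mul]
  linear_combination (-B.κ) * hθq

lemma re_inner_op_nonpos (U : (op B bc).domain) :
    (inner ℂ (U : PhaseSpace B) (op B bc U)).re ≤ 0 := by
  obtain ⟨k, hk, h⟩ := exists_le_re_inner_mulL2 B.L_pos B.δ_cont B.δ_pos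
  rw [re_inner_of_mem_graph_op ((op B bc).mem_graph U)]
  have hδ := (mul_nonneg hk.le (sq_nonneg _)).trans (h (dx0 B.L (u (op B bc U))))
  have hβ := mul_nonneg B.β_pos.le (sq_nonneg ‖q (U : PhaseSpace B)‖)
  linarith

end Operator

section Range

open PhaseSpace

variable {B : Beam} {bc : Boundary} {c : ℝ}

variable (B c) in
lemma continuousOn_smul_p_add_two_mul_δ :
    ContinuousOn (fun x => c * B.p x + 2 * B.δ x) (Icc 0 B.L) :=
  (B.p_cont.const_mul c).add (B.δ_cont.const_mul 2)

lemma smul_p_add_two_mul_δ_pos (hc : 0 < c) {x : ℝ} (hx : x ∈ Icc 0 B.L) :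
    0 < c * B.p x + 2 * B.δ x := by
  have hp := B.p_pos x hx
  have hδ := B.δ_pos x hx
  positivity

lemma continuousOn_inv_smul_p_add_two_mul_δ (hc : 0 < c) :
    ContinuousOn (fun x => (c * B.p x + 2 * B.δ x)⁻¹) (Icc 0 B.L) :=
  (continuousOn_smul_p_add_two_mul_δ B c).inv₀ fun _ hx => (smul_p_add_two_mul_δ_pos hc hx).ne'

variable (B) in
/-- Multiplication by `1 / (c p + 2 δ)`. Here `c p + 2 δ` is the coefficient of `w_x` in the
stress `p u_x + 2 δ w_x` of a solution `u = f + c w` of the first resolvent equation. -/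
def compliance (hc : 0 < c) : L2 B.L →L[ℂ] L2 B.L :=
  mulCLM _ (continuousOn_inv_smul_p_add_two_mul_δ hc)

lemma exists_le_re_inner_compliance (hc : 0 < c) :
    ∃ k : ℝ, 0 < k ∧ ∀ f, k * ‖f‖ ^ 2 ≤ (inner ℂ f (compliance B hc f)).re :=
  exists_le_re_inner_mulL2 B.L_pos (continuousOn_inv_smul_p_add_two_mul_δ hc)
    fun _ hx => inv_pos.mpr (smul_p_add_two_mul_δ_pos hc hx)

lemma exists_le_re_inner_inv_smul_m (hc : 0 < c) :
    ∃ k : ℝ, 0 < k ∧ ∀ f, k * ‖f‖ ^ 2 ≤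
      (inner ℂ f (((c⁻¹ : ℝ) : ℂ) • mulCLM B.m B.m_cont f)).re := by
  obtain ⟨k, hk, h⟩ := exists_le_re_inner_mulL2 B.L_pos B.m_cont B.m_pos
  refine ⟨c⁻¹ * k, by positivity, fun f => ?_⟩
  rw [inner_smul_right, Complex.re_ofReal_mul, mul_assoc]
  exact mul_le_mul_of_nonneg_left (h f) (by positivity)

lemma stress_add_smul (f v : H10 B.L) : stress B (f + (c : ℂ) • v) v =
    mulL2 B.p B.p_cont (dx0 B.L f) +
      mulL2 _ (continuousOn_smul_p_add_two_mul_δ B c) (dx0 B.L v) := by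
  rw [mulL2_linear_combination B.p_cont B.δ_cont, stress, map_add, map_add, map_smul, map_smul]
  push_cast
  exact add_assoc _ _ _

lemma stress_add_smul_eq_neg (hc : 0 < c) {f v : H10 B.L} {s : L2 B.L}
    (h : compliance B hc s + dx0 B.L v = -compliance B hc (mulL2 B.p B.p_cont (dx0 B.L f))) :
    stress B (f + (c : ℂ) • v) v = -s := by
  have hv : dx0 B.L v = -compliance B hc (s + mulL2 B.p B.p_cont (dx0 B.L f)) := by
    rw [map_add, neg_add, ← h]
    abel
  have hcancel : ∀ g, mulL2 _ (continuousOn_smul_p_add_two_mul_δ B c) (compliance B hc g) = g :=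
    mulL2_mulL2_of_mul_eq_one _ (continuousOn_inv_smul_p_add_two_mul_δ hc)
      fun x hx => mul_inv_cancel₀ (smul_p_add_two_mul_δ_pos hc hx).ne'
  rw [stress_add_smul, hv, map_neg, hcancel]
  abel

variable (bc) in
theorem exists_weak_resolvent_solution (hc : 0 < c) (F : PhaseSpace B) :
    ∃ (v : H10 B.L) (σx θ' θx q' qx : L2 B.L),
      (stress B (u F + (c : ℂ) • v) v - (B.η : ℂ) • θ', σx) ∈ weakGraph B.L ∧
      (θ', θx) ∈ bc.θGraph B.L ∧ (q', qx) ∈ bc.qGraph B.L ∧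
      mulL2 B.m B.m_cont v - (c : ℂ) • σx = mulL2 B.m B.m_cont (w F) ∧
      θ' + (c : ℂ) • ((B.κ : ℂ) • qx + (B.η : ℂ) • dx0 B.L v) = θ F ∧
      (B.τ : ℂ) • q' + (c : ℂ) • ((B.κ : ℂ) • θx + (B.β : ℂ) • q') = (B.τ : ℂ) • q F := by
  have hc₀ : (c : ℂ) ≠ 0 := by exact_mod_cast hc.ne'
  have hκ₀ : (B.κ : ℂ) ≠ 0 := by exact_mod_cast B.κ_pos.ne'
  have hγ : 0 < (B.τ + c * B.β) / (c * B.κ ^ 2) :=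
    div_pos (add_pos B.τ_pos (mul_pos hc B.β_pos)) (mul_pos hc (pow_pos B.κ_pos 2))
  obtain ⟨km, hkm, hm⟩ := exists_le_re_inner_inv_smul_m (B := B) hc
  obtain ⟨ka, hka, ha⟩ := exists_le_re_inner_compliance (B := B) hc
  set fp := compliance B hc (mulL2 B.p B.p_cont (dx0 B.L (u F)))
  -- The fourth unknown is `Q = κ q`, which makes the system skew-adjoint up to `m` and `a`.
  obtain ⟨v, v', σ, σ', θ', θx, Q, Qx, hv, hσ, hθ, hQ, e₀, e₁, e₂, e₃⟩ :=
    exists_stationary_solution (η := B.η) (isSkewAdjoint_closure_weakGraph B.L)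
      (isSkewAdjoint_weakGraph_closure B.L) bc.isSkewAdjoint_θGraph_qGraph
      bc.isSkewAdjoint_qGraph_θGraph hkm hka (inv_pos.mpr hc) hγ
      (m := ((c⁻¹ : ℝ) : ℂ) • mulCLM B.m B.m_cont) hm ha
      (((c⁻¹ : ℝ) : ℂ) • mulL2 B.m B.m_cont (w F)) (-fp)
      (((c⁻¹ : ℝ) : ℂ) • θ F + (B.η : ℂ) • fp) (((B.τ / (c * B.κ) : ℝ) : ℂ) • q F)
  lift v to H10 B.L using ⟨_, hv, rfl⟩
  rw [← show dx0 B.L v = v' from dx_eq (closure_testGraph_le hv) _] at e₁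
  replace e₀ : (c : ℂ)⁻¹ • mulL2 B.m B.m_cont v + σ' = (c : ℂ)⁻¹ • mulL2 B.m B.m_cont (w F) := by
    rw [← Complex.ofReal_inv]
    exact e₀
  rw [RCLike.ofReal_eq_complex_ofReal] at e₁ e₂ e₃
  push_cast at e₂ e₃
  refine ⟨v, -σ', θ', θx, (B.κ : ℂ)⁻¹ • Q, (B.κ : ℂ)⁻¹ • Qx, ?_, hθ,
    (bc.qGraph B.L).smul_mem _ hQ, ?_, ?_, ?_⟩
  · rw [stress_add_smul_eq_neg hc e₁, neg_sub, sub_right_comm, sub_self, zero_sub]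
    exact (weakGraph B.L).neg_mem hσ
  · linear_combination (norm := (match_scalars <;> field_simp <;> ring)) (c : ℂ) • e₀
  · linear_combination (norm := (match_scalars <;> field_simp <;> ring))
      (c : ℂ) • e₂ + (c * B.η : ℂ) • e₁
  · linear_combination (norm := (match_scalars <;> field_simp <;> ring)) (c * B.κ : ℂ) • e₃

lemma exists_sub_smul_op_eq (hc : 0 < c) (F : PhaseSpace B) :
    ∃ U : (op B bc).domain, (U : PhaseSpace B) - (c : ℂ) • op B bc U = F := by
  have hc₀ : (c : ℂ) ≠ 0 := by exact_mod_cast hc.ne'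
  obtain ⟨v, σx, θ', θx, q', qx, hσ, hθ, hq, hwF, hθF, hqF⟩ :=
    exists_weak_resolvent_solution bc hc F
  have hv : (c : ℂ)⁻¹ • (u F + (c : ℂ) • v - u F) = v := by
    rw [add_sub_cancel_left, inv_smul_smul₀ hc₀]
  have hV : (mk (u F + (c : ℂ) • v) v θ' q',
      (c : ℂ)⁻¹ • (mk (u F + (c : ℂ) • v) (v : L2 B.L) θ' q' - F)) ∈ (op B bc).graph := by
    refine mem_graph_op_of_weak ?_ ?_ hθ hq ?_ ?_ <;>
      simp only [map_smul, map_sub, u_mk, w_mk, θ_mk, q_mk, hv]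
    · have hσx : (c : ℂ)⁻¹ • (mulL2 B.m B.m_cont v - mulL2 B.m B.m_cont (w F)) = σx := by
        rw [← hwF, sub_sub_cancel, inv_smul_smul₀ hc₀]
      rwa [hσx]
    · rw [← hθF]
      match_scalars <;> field_simp
      ring
    · linear_combination (norm := (match_scalars <;> field_simp <;> ring)) (c : ℂ)⁻¹ • hqF
  obtain ⟨U, hU, hopU⟩ := LinearPMap.mem_graph_iff _ |>.mp hV
  refine ⟨U, ?_⟩
  rw [hU, hopU, smul_inv_smul₀ hc₀, sub_sub_cancel]

end Range

theorem isMaximalDissipative_op (B : Beam) (bc : Boundary) : IsMaximalDissipative (op B bc) where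
  re_inner_nonpos := re_inner_op_nonpos
  exists_sub_smul_eq _ hc := exists_sub_smul_op_eq hc

end Cattaneo

end

theorem theorem2p1 (B : Cattaneo.Beam) (bc : Cattaneo.Boundary) (U₀ : Cattaneo.PhaseSpace B) :
    (∃! U : C(NNReal, Cattaneo.PhaseSpace B),
      Cattaneo.IsMildSolution (Cattaneo.op B bc) U₀ U) ∧
    (U₀ ∈ (Cattaneo.op B bc).domain →
      ∀ U : C(NNReal, Cattaneo.PhaseSpace B), Cattaneo.IsMildSolution (Cattaneo.op B bc) U₀ U →
        Cattaneo.IsC1 U ∧ Cattaneo.IsContInDomain (Cattaneo.op B bc) U ∧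
          Cattaneo.IsStrongSolution (Cattaneo.op B bc) U₀ U) :=
  have hA := Cattaneo.isMaximalDissipative_op B bc
  ⟨hA.existsUnique_isMildSolution U₀,
    fun h _ hU => hA.isC1_and_isContInDomain_and_isStrongSolution h hU⟩
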